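/- Let $0<\bar\epsilon<1$. The state $\omega$ is uniform on $[-1,1]$. One of two speakers, each with probability $\tfrac12$ independently of everything else, is the expert, who observes $\omega$; the other is the quack, who does not. The speakers know who is who. They simultaneously send messages $m_1,m_2\in[-1,1]$. The judge observes $m_1,m_2$ and a signal $s=\omega+\epsilon$ with $\epsilon$ uniform on $[-\bar\epsilon,\bar\epsilon]$, independent of the rest, but not the speakers' identities; she then selects one speaker, according to a measurable selection rule $\phi$ that assigns to each $(m_1,m_2,s)$ a lottery over $\{1,2\}$. The judge gets $1$ if she selects the expert and $0$ otherwise; a speaker gets $1$ if he is selected and $0$ otherwise. An expert's strategy is a Markov kernel from states to messages, a quack's strategy is a probability distribution on messages, and both may depend on the speaker's name. In an equilibrium (perfect Bayesian equilibrium) each speaker in each role maximizes his probability of being selected, and at every $(m_1,m_2,s)$ the judge's rule puts weight only on speakers most likely to be the expert under some belief system that is a version of the conditional probability of the expert's identity given $(m_1,m_2,s)$. A message $m$ is consistent with $s$ if $|m-s|\le\bar\epsilon$. Theorem. (1) Every equilibrium in which the expert always reports $m=\omega$ and the quack draws his message from the prior $\mathcal U[-1,1]$ maximizes the judge's ex-ante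 probability of selecting the expert over all equilibria. (2) Such equilibria exist, and they are supported by different selection rules that reward extreme messages. Precisely, there are two selection rules $\phi_{\max}$ and $\phi_{\min}$, which differ with positive probability in this outcome, such that each of them supports the outcome of (1) as an equilibrium (with truth-telling optimal for the expert at every state $\omega$), treats the two speakers symmetrically, selects the sender of the consistent message whenever exactly one message is consistent, and, whenever both messages are consistent and $|m_1|\neq|m_2|$, selects the sender of the message with the larger absolute value with probability greater than $\tfrac12$. When both messages are consistent and $|m_1|\ne|m_2|$, the probability that $\phi_{\max}$ selects the more extreme speaker depends only on $\max\{|m_1|,|m_2|\}$, and the probability that $\phi_{\min}$ selects the more moderate speaker depends only on $\min\{|m_1|,|m_2|\}$. -/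

import Mathlib

open MeasureTheory ProbabilityTheory Set

noncomputable section

namespace JudgeGame

/-- The common space `[-1, 1]` of states and of messages. -/
abbrev Message : Type := Set.Icc (-1 : ℝ) 1

/-- What the judge observes: speaker 1's message, speaker 2's message, her private signal. -/
abbrev Obs : Type := Message × Message × ℝ

/-- The uniform distribution on the state (and message) space `[-1, 1]`. -/
def prior : Measure Message :=
  (ProbabilityTheory.cond (volume : Measure ℝ) (Set.Icc (-1) 1)).comap Subtype.val

instance : IsProbabilityMeasure prior := by
  constructor
  have h : Set.range (Subtype.val : Message → ℝ) = Set.Icc (-1) 1 := Subtype.range_coe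
  rw [prior, (MeasurableEmbedding.subtype_coe measurableSet_Icc).comap_apply, Set.image_univ, h]
  apply ProbabilityTheory.cond_apply_self
  · simp
  · simp

/-- The noise in the judge's signal: uniform on `[-ε, ε]`. -/
def noise (ε : ℝ) : Measure ℝ :=
  ProbabilityTheory.cond (volume : Measure ℝ) (Set.Icc (-ε) ε)

/-- The judge's observation when speaker `i` is the expert, the state is `ω`, the expert sends `a`,
the quack sends `b`, and the noise is `e`; the signal is `ω + e`. Index `0` is speaker 1 and index
`1` is speaker 2. -/
def arrange (i : Fin 2) (x : ((Message × Message) × Message) × ℝ) : Obs :=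
  let ω : Message := x.1.1.1
  let a : Message := x.1.1.2
  let b : Message := x.1.2
  let e : ℝ := x.2
  if i = 0 then (a, b, (ω : ℝ) + e) else (b, a, (ω : ℝ) + e)

/-- The law of the judge's observation when speaker `i` is the expert, the state has law `ρ`, the
expert uses the messaging kernel `κ` (message law given the state), and the quack, who does not
observe the state, draws his message from `q`. -/
def obsLaw (ε : ℝ) (ρ : Measure Message) (i : Fin 2) (κ : Kernel Message Message)
    (q : Measure Message) : Measure Obs :=
  (((ρ ⊗ₘ κ).prod q).prod (noise ε)).map (arrange i)

/-- A messaging strategy for each speaker in each role. The speakers know who is the expert, so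
the strategies may depend on the speaker's name. -/
structure Profile where
  /-- the strategy of speaker `i` when he is the expert -/
  expert : Fin 2 → Kernel Message Message
  expert_markov : ∀ i, IsMarkovKernel (expert i)
  /-- the strategy of speaker `i` when he is the quack -/
  quack : Fin 2 → Measure Message
  quack_prob : ∀ i, IsProbabilityMeasure (quack i)

/-- A measurable map from the judge's observations to lotteries over the two speakers. -/
structure SpeakerLottery where
  prob : Fin 2 → Obs → ℝ
  measurable_prob : ∀ j, Measurable (prob j)
  prob_nonneg : ∀ j x, 0 ≤ prob j x
  sum_prob : ∀ x, prob 0 x + prob 1 x = 1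

/-- A selection rule: `prob j x` is the probability that the judge selects speaker `j` at `x`. -/
abbrev SelectionRule : Type := SpeakerLottery

/-- A belief system: `prob j x` is the probability, in the judge's mind at `x`, that speaker `j`
is the expert. -/
abbrev Belief : Type := SpeakerLottery

/-- The ex-ante law of the judge's observation when speaker `i` is the expert. -/
def lawIfExpert (ε : ℝ) (P : Profile) (i : Fin 2) : Measure Obs :=
  obsLaw ε prior i (P.expert i) (P.quack i.rev)

/-- The ex-ante law of the judge's observation; each speaker is the expert with probability
one half. -/
def totalLaw (ε : ℝ) (P : Profile) : Measure Obs :=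
  (2⁻¹ : ENNReal) • lawIfExpert ε P 0 + (2⁻¹ : ENNReal) • lawIfExpert ε P 1

/-- The probability that speaker `j` is selected when the observation has law `L`. -/
def selProb (φ : SelectionRule) (j : Fin 2) (L : Measure Obs) : ℝ := ∫ x, φ.prob j x ∂L

/-- The judge's ex-ante payoff: the probability that she selects the expert. -/
def judgePayoff (ε : ℝ) (P : Profile) (φ : SelectionRule) : ℝ :=
  (selProb φ 0 (lawIfExpert ε P 0) + selProb φ 1 (lawIfExpert ε P 1)) / 2

/-- `β` is a version of the conditional probability of the expert's identity given the judge's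
observation. -/
def BayesConsistent (ε : ℝ) (P : Profile) (β : Belief) : Prop :=
  ∀ j, ∀ A : Set Obs, MeasurableSet A →
    ∫ x in A, β.prob j x ∂(totalLaw ε P) = (1 / 2) * (lawIfExpert ε P j).real A

/-- Perfect Bayesian equilibrium: each speaker, in each role, maximizes the probability that he is
selected, and at every observation the judge selects only speakers who are most likely to be the
expert according to some Bayes-consistent belief system. -/
structure IsEquilibrium (ε : ℝ) (P : Profile) (φ : SelectionRule) : Prop where
  expert_optimal : ∀ (i : Fin 2) (κ : Kernel Message Message), IsMarkovKernel κ →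
    selProb φ i (obsLaw ε prior i κ (P.quack i.rev)) ≤
      selProb φ i (obsLaw ε prior i (P.expert i) (P.quack i.rev))
  quack_optimal : ∀ (i : Fin 2) (q : Measure Message), IsProbabilityMeasure q →
    selProb φ i (obsLaw ε prior i.rev (P.expert i.rev) q) ≤
      selProb φ i (obsLaw ε prior i.rev (P.expert i.rev) (P.quack i))
  judge_optimal : ∃ β : Belief, BayesConsistent ε P β ∧
    ∀ (x : Obs) (j k : Fin 2), 0 < φ.prob j x → β.prob k x ≤ β.prob j x

/-- The expert's strategy is optimal at every single state, not only on average over states. -/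
def ExpertOptimalAtEveryState (ε : ℝ) (P : Profile) (φ : SelectionRule) : Prop :=
  ∀ (i : Fin 2) (ω : Message) (κ : Kernel Message Message), IsMarkovKernel κ →
    selProb φ i (obsLaw ε (Measure.dirac ω) i κ (P.quack i.rev)) ≤
      selProb φ i (obsLaw ε (Measure.dirac ω) i (P.expert i) (P.quack i.rev))

/-- An equilibrium that gives the judge at least the payoff of any other equilibrium. -/
def IsBestEquilibrium (ε : ℝ) (P : Profile) (φ : SelectionRule) : Prop :=
  IsEquilibrium ε P φ ∧
    ∀ (Q : Profile) (ψ : SelectionRule), IsEquilibrium ε Q ψ →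
      judgePayoff ε Q ψ ≤ judgePayoff ε P φ

/-- The expert always reports the true state; the quack draws his message from the prior. -/
def truthfulUniform : Profile where
  expert := fun _ => Kernel.id
  expert_markov := fun _ => inferInstance
  quack := fun _ => prior
  quack_prob := fun _ => inferInstance

/-- A message is consistent with a signal if it may be the true state. -/
def Consistent (ε : ℝ) (m : Message) (s : ℝ) : Prop := |(m : ℝ) - s| ≤ ε

/-- The rule treats the two speakers symmetrically. -/
def SymmetricRule (φ : SelectionRule) : Prop :=
  ∀ (m m' : Message) (s : ℝ), φ.prob 0 (m, m', s) = φ.prob 1 (m', m, s)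

/-- If exactly one message is consistent, its sender is selected for sure. -/
def SelectsUniqueConsistent (ε : ℝ) (φ : SelectionRule) : Prop :=
  ∀ (m₁ m₂ : Message) (s : ℝ),
    (Consistent ε m₁ s → ¬ Consistent ε m₂ s → φ.prob 0 (m₁, m₂, s) = 1) ∧
    (¬ Consistent ε m₁ s → Consistent ε m₂ s → φ.prob 1 (m₁, m₂, s) = 1)

/-- If both messages are consistent, the sender of the more extreme one is selected with
probability above one half. -/
def FavorsExtreme (ε : ℝ) (φ : SelectionRule) : Prop :=
  ∀ (m₁ m₂ : Message) (s : ℝ), Consistent ε m₁ s → Consistent ε m₂ s →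
    (|(m₂ : ℝ)| < |(m₁ : ℝ)| → 1 / 2 < φ.prob 0 (m₁, m₂, s)) ∧
    (|(m₁ : ℝ)| < |(m₂ : ℝ)| → 1 / 2 < φ.prob 1 (m₁, m₂, s))

/-- If both messages are consistent, the more extreme speaker is selected with a probability that
depends only on the larger magnitude. -/
def IsMaxRule (ε : ℝ) (φ : SelectionRule) : Prop :=
  ∃ g : ℝ → ℝ, ∀ (m₁ m₂ : Message) (s : ℝ), Consistent ε m₁ s → Consistent ε m₂ s →
    (|(m₂ : ℝ)| < |(m₁ : ℝ)| → φ.prob 0 (m₁, m₂, s) = g (max |(m₁ : ℝ)| |(m₂ : ℝ)|)) ∧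
    (|(m₁ : ℝ)| < |(m₂ : ℝ)| → φ.prob 1 (m₁, m₂, s) = g (max |(m₁ : ℝ)| |(m₂ : ℝ)|))

/-- If both messages are consistent, the more moderate speaker is selected with a probability that
depends only on the smaller magnitude. -/
def IsMinRule (ε : ℝ) (φ : SelectionRule) : Prop :=
  ∃ g : ℝ → ℝ, ∀ (m₁ m₂ : Message) (s : ℝ), Consistent ε m₁ s → Consistent ε m₂ s →
    (|(m₁ : ℝ)| < |(m₂ : ℝ)| → φ.prob 0 (m₁, m₂, s) = g (min |(m₁ : ℝ)| |(m₂ : ℝ)|)) ∧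
    (|(m₂ : ℝ)| < |(m₁ : ℝ)| → φ.prob 1 (m₁, m₂, s) = g (min |(m₁ : ℝ)| |(m₂ : ℝ)|))

/-- The rule supports the truthful-expert, uniform-quack outcome as a best equilibrium of the
judge, treats the speakers symmetrically, and rewards extreme messages. -/
structure SupportsRewardingExtremes (ε : ℝ) (φ : SelectionRule) : Prop where
  best : IsBestEquilibrium ε truthfulUniform φ
  every_state : ExpertOptimalAtEveryState ε truthfulUniform φ
  symmetric : SymmetricRule φ
  unique_consistent : SelectsUniqueConsistent ε φ
  favors_extreme : FavorsExtreme ε φ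

end JudgeGame

end

noncomputable section

namespace JudgeGame

/-! Part (1) is a simulation argument. In any equilibrium a quack could imitate the marginal message
law of the expert of the same name. By optimality this does not raise his chance of selection, so it
does not lower the judge's payoff. The resulting play is a garbling of truthful play against a
uniform quack: pass each speaker's message through that speaker's expert kernel and keep the signal.
Hence a judge who faces truthful messages can reproduce that payoff (`selProb_garbledRule`), and her
Bayes-optimal rule does at least as well (`judgePayoff_le_of_bayesConsistent`).

For part (2), note that in the truthful-uniform outcome two consistent messages are equally likely
to come from the expert. The judge may then use any antisymmetric bias `η` and select the first
speaker with probability `1/2 + η`. The quack is indifferent among all messages iff `∫ overlap (m -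
y) * η m y` equals a constant minus half the total overlap of `m`. If `η` depends only on the larger
or only on the smaller magnitude, this becomes a Volterra-type integral equation on `[0, 1]` for one
weight; for the max rule one substitutes `1 - x`.

The coefficient `b` of the unknown vanishes at `1`, so the equation is singular there. After
differentiation and multiplication by a high power of `1 - t`, its integrated form is a fixed-point
equation for a monotone operator with `1/2` as supersolution. Its least fixed point therefore exists
and lies in `[0, 1/2]`; `EquationData.solution_spec` recovers the original equation. Positivity
propagates from the source term, by way of the kernel in the case of the max rule.

Truth-telling then needs no further choice of `η`. By `IsIndifferentBias.integral_overlap₃_le`, a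
lie at distance `r * 2ε` from the state, with `r ≤ 1`, costs consistency with probability `r`, and
this outweighs any gain from the bias. Finally, if the two rules agreed almost surely, fixing one
extreme message would make the max weight constant near `1`, which its equation forbids. -/

theorem isProbabilityMeasure_noise {ε : ℝ} (hε : 0 < ε) : IsProbabilityMeasure (noise ε) := by
  apply ProbabilityTheory.cond_isProbabilityMeasure_of_finite
  · simp [hε]
  · simp

/-! ### Laws of the judge's observation. -/

theorem measurable_arrange (i : Fin 2) : Measurable (arrange i) := by
  unfold arrange
  fin_cases i
  · simp only [Fin.zero_eta, if_true]
    fun_prop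
  · simp only [Fin.mk_one, one_ne_zero, if_false]
    fun_prop

theorem lintegral_obsLaw {ε : ℝ} (hε : 0 < ε) (ρ : Measure Message) [IsProbabilityMeasure ρ]
    (i : Fin 2) (κ : Kernel Message Message) [IsMarkovKernel κ] (q : Measure Message)
    [IsProbabilityMeasure q] {f : Obs → ENNReal} (hf : Measurable f) :
    ∫⁻ x, f x ∂obsLaw ε ρ i κ q =
      ∫⁻ ω, ∫⁻ a, ∫⁻ b, ∫⁻ e, f (arrange i (((ω, a), b), e)) ∂noise ε ∂q ∂κ ω ∂ρ := by
  have := isProbabilityMeasure_noise hε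
  have hg : Measurable fun x => f (arrange i x) := hf.comp (measurable_arrange i)
  rw [obsLaw, lintegral_map hf (measurable_arrange i),
    lintegral_prod _ hg.aemeasurable, lintegral_prod _ (hg.lintegral_prod_right').aemeasurable,
    Measure.lintegral_compProd (hg.lintegral_prod_right').lintegral_prod_right']

theorem isProbabilityMeasure_obsLaw {ε : ℝ} (hε : 0 < ε) (ρ : Measure Message)
    [IsProbabilityMeasure ρ] (i : Fin 2) (κ : Kernel Message Message) [IsMarkovKernel κ]
    (q : Measure Message) [IsProbabilityMeasure q] : IsProbabilityMeasure (obsLaw ε ρ i κ q) := by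
  have := isProbabilityMeasure_noise hε
  exact Measure.isProbabilityMeasure_map (measurable_arrange i).aemeasurable

theorem SpeakerLottery.prob_le_one (φ : SpeakerLottery) (j : Fin 2) (x : Obs) :
    φ.prob j x ≤ 1 := by
  have := φ.sum_prob x
  have h0 := φ.prob_nonneg 0 x
  have h1 := φ.prob_nonneg 1 x
  fin_cases j
  · simp only [Fin.zero_eta]; linarith
  · simp only [Fin.mk_one]; linarith

theorem SpeakerLottery.integrable_prob (φ : SpeakerLottery) (j : Fin 2) (L : Measure Obs)
    [IsFiniteMeasure L] : Integrable (φ.prob j) L := by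
  refine Integrable.of_bound (φ.measurable_prob j).aestronglyMeasurable 1 (ae_of_all _ fun x => ?_)
  rw [Real.norm_of_nonneg (φ.prob_nonneg j x)]
  exact φ.prob_le_one j x

theorem selProb_add (φ : SelectionRule) (L : Measure Obs) [IsProbabilityMeasure L] :
    selProb φ 0 L + selProb φ 1 L = 1 := by
  rw [selProb, selProb, ← integral_add (φ.integrable_prob 0 L) (φ.integrable_prob 1 L)]
  simp [φ.sum_prob]

/-! ### Simulating arbitrary play from truthful messages. -/

/-- Both messages are passed through the experts' kernels; the signal is kept. -/
def garbling (κ : Fin 2 → Kernel Message Message) : Kernel Obs Obs :=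
  ((κ 0).comap Prod.fst measurable_fst) ×ₖ
    (((κ 1).comap (fun x : Obs => x.2.1) (by fun_prop)) ×ₖ
      Kernel.deterministic (fun x : Obs => x.2.2) (by fun_prop))

instance (κ : Fin 2 → Kernel Message Message) [∀ i, IsMarkovKernel (κ i)] :
    IsMarkovKernel (garbling κ) := by
  unfold garbling; infer_instance

theorem lintegral_garbling (κ : Fin 2 → Kernel Message Message) [∀ i, IsMarkovKernel (κ i)]
    {f : Obs → ENNReal} (hf : Measurable f) (m₁ m₂ : Message) (s : ℝ) :
    ∫⁻ x, f x ∂garbling κ (m₁, m₂, s) = ∫⁻ a, ∫⁻ b, f (a, b, s) ∂κ 1 m₂ ∂κ 0 m₁ := by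
  rw [garbling, Kernel.lintegral_prod _ _ _ hf]
  simp only [Kernel.comap_apply]
  refine lintegral_congr fun a => ?_
  rw [Kernel.lintegral_prod _ _ _ (by fun_prop)]
  simp only [Kernel.comap_apply]
  refine lintegral_congr fun b => ?_
  rw [Kernel.deterministic_apply, lintegral_dirac]

/-- The garbling acts on names, not on roles. The true state fed into `κ i` becomes the message of
expert `i`, while the uniform message fed into `κ i.rev` gets the law `prior.bind (κ i.rev)`. The
two are drawn independently given the state and the signal is unchanged, so only the order of
integration has to be rearranged. -/
theorem lintegral_bind_obsLaw_truthful {ε : ℝ} (hε : 0 < ε) (κ : Fin 2 → Kernel Message Message)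
    [∀ i, IsMarkovKernel (κ i)] (i : Fin 2) {f : Obs → ENNReal} (hf : Measurable f) :
    ∫⁻ x, ∫⁻ y, f y ∂garbling κ x ∂obsLaw ε prior i Kernel.id prior =
      ∫⁻ x, f x ∂obsLaw ε prior i (κ i) (prior.bind (κ i.rev)) := by
  have := isProbabilityMeasure_noise hε
  rw [lintegral_obsLaw hε _ _ _ _ hf, lintegral_obsLaw hε _ _ _ _ hf.lintegral_kernel]
  refine lintegral_congr fun ω => ?_
  have hm : Measurable fun a => ∫⁻ b, ∫⁻ e, ∫⁻ y, f y ∂garbling κ (arrange i (((ω, a), b), e))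
      ∂noise ε ∂prior := by
    have := measurable_arrange i
    have h1 : Measurable fun (x : (Message × Message) × ℝ) =>
        ∫⁻ y, f y ∂garbling κ (arrange i (((ω, x.1.1), x.1.2), x.2)) :=
      hf.lintegral_kernel.comp (this.comp (by fun_prop))
    exact h1.lintegral_prod_right'.lintegral_prod_right'
  rw [Kernel.id_apply, lintegral_dirac' _ hm]
  have hb (a : Message) : ∫⁻ b, ∫⁻ e, f (arrange i (((ω, a), b), e))
        ∂noise ε ∂(prior.bind (κ i.rev))
      = ∫⁻ m, ∫⁻ b, ∫⁻ e, f (arrange i (((ω, a), b), e)) ∂noise ε ∂κ i.rev m ∂prior := by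
    apply Measure.lintegral_bind (Kernel.aemeasurable _)
    have h1 : Measurable fun x : Message × ℝ => f (arrange i (((ω, a), x.1), x.2)) :=
      hf.comp ((measurable_arrange i).comp (by fun_prop))
    exact h1.lintegral_prod_right'.aemeasurable
  simp_rw [hb]
  have hF : Measurable fun x : (Message × Message) × ℝ =>
      f (arrange i (((ω, x.1.1), x.1.2), x.2)) :=
    hf.comp ((measurable_arrange i).comp (by fun_prop))
  have hF' := hF.lintegral_prod_right' (ν := noise ε)
  rw [lintegral_lintegral_swap
    (f := fun a m => ∫⁻ b, ∫⁻ e, f (arrange i (((ω, a), b), e)) ∂noise ε ∂κ i.rev m)]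
  swap
  · have h2 : Measurable fun x : (Message × Message) × Message =>
        ∫⁻ e, f (arrange i (((ω, x.1.1), x.2), e)) ∂noise ε :=
      hF'.comp (by fun_prop : Measurable fun x : (Message × Message) × Message => (x.1.1, x.2))
    exact (h2.lintegral_kernel_prod_right'
      (κ := (κ i.rev).comap (Prod.snd : Message × Message → Message) measurable_snd)).aemeasurable
  refine lintegral_congr fun m => ?_
  calc ∫⁻ e, ∫⁻ y, f y ∂garbling κ (arrange i (((ω, ω), m), e)) ∂noise ε
      = ∫⁻ e, ∫⁻ a, ∫⁻ b, f (arrange i (((ω, a), b), e)) ∂κ i.rev m ∂κ i ω ∂noise ε := by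
        refine lintegral_congr fun e => ?_
        fin_cases i
        · simp only [arrange, Fin.zero_eta, if_true]
          exact lintegral_garbling κ hf _ _ _
        · simp only [arrange, Fin.mk_one, one_ne_zero, if_false]
          rw [lintegral_garbling κ hf, lintegral_lintegral_swap]
          · rfl
          · exact (hf.comp (by fun_prop : Measurable fun x : Message × Message =>
              ((x.1, x.2, (ω : ℝ) + e) : Obs))).aemeasurable
    _ = ∫⁻ a, ∫⁻ e, ∫⁻ b, f (arrange i (((ω, a), b), e)) ∂κ i.rev m ∂noise ε ∂κ i ω := by
        rw [lintegral_lintegral_swap]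
        have h3 : Measurable fun x : (ℝ × Message) × Message =>
          f (arrange i (((ω, x.1.2), x.2), x.1.1)) :=
            hF.comp (by fun_prop : Measurable fun x : (ℝ × Message) × Message =>
              ((x.1.2, x.2), x.1.1))
        exact h3.lintegral_prod_right'.aemeasurable
    _ = _ := by
        refine lintegral_congr fun a => ?_
        rw [lintegral_lintegral_swap]
        exact (hF.comp (by fun_prop : Measurable fun x : ℝ × Message =>
              ((a, x.2), x.1))).aemeasurable

/-- Select as `ψ` would after the messages have been garbled. -/
def garbledRule (κ : Fin 2 → Kernel Message Message) [∀ i, IsMarkovKernel (κ i)]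
    (ψ : SelectionRule) : SelectionRule where
  prob j x := ∫ y, ψ.prob j y ∂garbling κ x
  measurable_prob j := (ψ.measurable_prob j).stronglyMeasurable.integral_kernel.measurable
  prob_nonneg j _ := integral_nonneg (ψ.prob_nonneg j)
  sum_prob x := selProb_add ψ (garbling κ x)

theorem selProb_garbledRule {ε : ℝ} (hε : 0 < ε) (κ : Fin 2 → Kernel Message Message)
    [∀ i, IsMarkovKernel (κ i)] (ψ : SelectionRule) (i j : Fin 2) :
    selProb (garbledRule κ ψ) j (obsLaw ε prior i Kernel.id prior) =
      selProb ψ j (obsLaw ε prior i (κ i) (prior.bind (κ i.rev))) := by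
  have hm := (ψ.measurable_prob j).ennreal_ofReal
  rw [selProb, selProb,
    integral_eq_lintegral_of_nonneg_ae (ae_of_all _ (ψ.prob_nonneg j))
      (ψ.measurable_prob j).aestronglyMeasurable,
    integral_eq_lintegral_of_nonneg_ae (ae_of_all _ ((garbledRule κ ψ).prob_nonneg j))
      ((garbledRule κ ψ).measurable_prob j).aestronglyMeasurable,
    ← lintegral_bind_obsLaw_truthful hε κ i hm]
  congr 1
  refine lintegral_congr fun x => ?_
  exact ofReal_integral_eq_lintegral_ofReal (ψ.integrable_prob j _)
    (ae_of_all _ (ψ.prob_nonneg j))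

/-! ### Bayes-optimal selection and the best equilibrium. -/

instance (P : Profile) (i : Fin 2) : IsMarkovKernel (P.expert i) := P.expert_markov i
instance (P : Profile) (i : Fin 2) : IsProbabilityMeasure (P.quack i) := P.quack_prob i

theorem isProbabilityMeasure_lawIfExpert {ε : ℝ} (hε : 0 < ε) (P : Profile) (i : Fin 2) :
    IsProbabilityMeasure (lawIfExpert ε P i) :=
  isProbabilityMeasure_obsLaw hε _ _ _ _

theorem isProbabilityMeasure_totalLaw {ε : ℝ} (hε : 0 < ε) (P : Profile) :
    IsProbabilityMeasure (totalLaw ε P) := by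
  have := isProbabilityMeasure_lawIfExpert hε P
  constructor
  simp [totalLaw, ENNReal.inv_two_add_inv_two]

/-- In the judge's payoff the law given the expert's identity may be replaced by the belief. -/
theorem BayesConsistent.selProb_eq {ε : ℝ} (hε : 0 < ε) {P : Profile} {β : Belief}
    (hβ : BayesConsistent ε P β) (φ : SelectionRule) (j : Fin 2) :
    selProb φ j (lawIfExpert ε P j) / 2 = ∫ x, β.prob j x * φ.prob j x ∂totalLaw ε P := by
  have := isProbabilityMeasure_lawIfExpert hε P
  have := isProbabilityMeasure_totalLaw hε P
  -- Bayes consistency says that the belief is the Radon–Nikodym density of half the conditional law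
  -- with respect to the total law.
  have key : (totalLaw ε P).withDensity (fun x => ENNReal.ofReal (β.prob j x)) =
      (2⁻¹ : ENNReal) • lawIfExpert ε P j := by
    ext A hA
    rw [withDensity_apply _ hA, ← ofReal_integral_eq_lintegral_ofReal
      (β.integrable_prob j _).integrableOn (ae_of_all _ (β.prob_nonneg j)), hβ j A hA,
      ENNReal.ofReal_mul (by norm_num), ofReal_measureReal]
    simp
  have h2 : ∫ x, φ.prob j x ∂((2⁻¹ : ENNReal) • lawIfExpert ε P j) =
      selProb φ j (lawIfExpert ε P j) / 2 := by
    rw [integral_smul_measure, selProb]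
    simp
    ring
  rw [← h2, ← key, integral_withDensity_eq_integral_toReal_smul
    (β.measurable_prob j).ennreal_ofReal (by simp)]
  refine integral_congr_ae (ae_of_all _ fun x => ?_)
  simp [ENNReal.toReal_ofReal (β.prob_nonneg j x)]

/-- A rule that only selects speakers most likely to be the expert is optimal for the judge. -/
theorem judgePayoff_le_of_bayesConsistent {ε : ℝ} (hε : 0 < ε) {P : Profile} {β : Belief}
    (hβ : BayesConsistent ε P β) {φ : SelectionRule}
    (hφ : ∀ (x : Obs) (j k : Fin 2), 0 < φ.prob j x → β.prob k x ≤ β.prob j x)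
    (φ' : SelectionRule) : judgePayoff ε P φ' ≤ judgePayoff ε P φ := by
  have := isProbabilityMeasure_totalLaw hε P
  have hint (χ : SelectionRule) (j : Fin 2) :
      Integrable (fun x => β.prob j x * χ.prob j x) (totalLaw ε P) := by
    refine Integrable.of_bound
      ((β.measurable_prob j).mul (χ.measurable_prob j)).aestronglyMeasurable 1
      (ae_of_all _ fun x => ?_)
    rw [Real.norm_of_nonneg (mul_nonneg (β.prob_nonneg j x) (χ.prob_nonneg j x))]
    exact mul_le_one₀ (β.prob_le_one j x) (χ.prob_nonneg j x) (χ.prob_le_one j x)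
  have hpay (χ : SelectionRule) : judgePayoff ε P χ =
      ∫ x, (β.prob 0 x * χ.prob 0 x + β.prob 1 x * χ.prob 1 x) ∂totalLaw ε P := by
    rw [integral_add (hint χ 0) (hint χ 1), ← hβ.selProb_eq hε, ← hβ.selProb_eq hε, judgePayoff,
      add_div]
  rw [hpay, hpay]
  refine integral_mono ((hint φ' 0).add (hint φ' 1)) ((hint φ 0).add (hint φ 1)) fun x => ?_
  simp only
  have e1 := φ.sum_prob x
  have e2 := φ'.sum_prob x
  have n0 := φ.prob_nonneg 0 x
  have n1 := φ.prob_nonneg 1 x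
  have n0' := φ'.prob_nonneg 0 x
  have n1' := φ'.prob_nonneg 1 x
  rcases lt_trichotomy (β.prob 0 x) (β.prob 1 x) with h | h | h
  · have : φ.prob 0 x = 0 := by
      by_contra h0
      exact absurd (hφ x 0 1 (lt_of_le_of_ne n0 (Ne.symm h0))) (not_le.2 h)
    have e3 : φ.prob 1 x = 1 := by linarith
    have e4 : φ'.prob 1 x = 1 - φ'.prob 0 x := by linarith
    rw [this, e3, e4]
    nlinarith
  · rw [h, ← mul_add, ← mul_add, e1, e2]
  · have : φ.prob 1 x = 0 := by
      by_contra h0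
      exact absurd (hφ x 1 0 (lt_of_le_of_ne n1 (Ne.symm h0))) (not_le.2 h)
    have e3 : φ.prob 0 x = 1 := by linarith
    have e4 : φ'.prob 0 x = 1 - φ'.prob 1 x := by linarith
    rw [this, e3, e4]
    nlinarith

/-- Every equilibrium with a truthful expert and a uniform quack is best for the judge: in any other
equilibrium a quack could mimic the message distribution of the expert, and the judge could
simulate the resulting play from truthful messages. -/
theorem isBestEquilibrium_truthfulUniform {ε : ℝ} (hε : 0 < ε) {φ : SelectionRule}
    (hφ : IsEquilibrium ε truthfulUniform φ) : IsBestEquilibrium ε truthfulUniform φ := by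
  refine ⟨hφ, fun Q ψ hQ => ?_⟩
  obtain ⟨β, hβ, hβφ⟩ := hφ.judge_optimal
  refine le_trans ?_ (judgePayoff_le_of_bayesConsistent hε hβ hβφ (garbledRule Q.expert ψ))
  -- Each quack imitates the expert of his own name, since the garbling cannot tell the roles apart.
  have h0 := hQ.quack_optimal 0 (prior.bind (Q.expert 0)) inferInstance
  have h1 := hQ.quack_optimal 1 (prior.bind (Q.expert 1)) inferInstance
  have g0 := selProb_garbledRule hε Q.expert ψ 0 0
  have g1 := selProb_garbledRule hε Q.expert ψ 1 1
  simp only [judgePayoff, lawIfExpert, truthfulUniform] at *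
  rw [g0, g1]
  have p (i : Fin 2) (q : Measure Message) [IsProbabilityMeasure q] :=
    isProbabilityMeasure_obsLaw hε prior i (Q.expert i) q
  have r0 : (0 : Fin 2).rev = 1 := rfl
  have r1 : (1 : Fin 2).rev = 0 := rfl
  simp only [r0, r1] at *
  have s1 := selProb_add ψ (obsLaw ε prior 0 (Q.expert 0) (prior.bind (Q.expert 1)))
  have s2 := selProb_add ψ (obsLaw ε prior 1 (Q.expert 1) (prior.bind (Q.expert 0)))
  have s3 := selProb_add ψ (obsLaw ε prior 0 (Q.expert 0) (Q.quack 1))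
  have s4 := selProb_add ψ (obsLaw ε prior 1 (Q.expert 1) (Q.quack 0))
  linarith

/-! ### A singular integral equation solved by a least fixed point. -/

/-- Data of the integral equation
`b x * d x = ∫ t in x..1, σ t + ∫ y in 0..x, k x y * d y - const` on `[0, 1]`, where `b` vanishes at
`1`, `-p` is the derivative of `k` in its first variable, `-β` is the derivative of `b`, and the
constant function `1/2` is a supersolution of the differentiated equation. -/
structure EquationData where
  k : ℝ → ℝ → ℝ
  p : ℝ → ℝ → ℝ
  σ : ℝ → ℝ
  b : ℝ → ℝ
  β : ℝ → ℝ
  n : ℕ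
  bound : ℝ
  continuous_k : Continuous (Function.uncurry k)
  measurable_p : Measurable (Function.uncurry p)
  p_nonneg : ∀ t y, 0 ≤ p t y
  p_le : ∀ t y, p t y ≤ bound
  integral_p : ∀ x y, 0 ≤ y → y ≤ x → x ≤ 1 → ∫ t in x..1, p t y = k x y - k 1 y
  continuous_σ : Continuous σ
  σ_nonneg : ∀ t ∈ Icc (0 : ℝ) 1, 0 ≤ σ t
  hasDerivAt_b : ∀ x, HasDerivAt b (-β x) x
  continuous_β : Continuous β
  b_one : b 1 = 0
  b_pos : ∀ x ∈ Ico (0 : ℝ) 1, 0 < b x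
  -- Differentiation produces the term `-k t t * d t`, which has the wrong sign for a monotone
  -- operator. The weight `(1 - t) ^ (n + 1)` adds `(n + 1) * (1 - t) ^ n * b t` to the coefficient
  -- of `d t`, and this condition makes the sum nonnegative.
  diag_le : ∀ t ∈ Ico (0 : ℝ) 1, (1 - t) * k t t ≤ (n + 1) * b t
  -- For `d = 1/2` the differentiated equation `-(b * d)' = σ + ∫ p * d - k * d` has left side `β /
  -- 2`; the required inequality is that this dominates the right side.
  half_supersolution : ∀ t ∈ Ioo (0 : ℝ) 1,
    σ t + (∫ y in 0..t, p t y) / 2 ≤ (k t t + β t) / 2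

namespace EquationData

variable (D : EquationData)

open scoped ENNReal

theorem continuous_b : Continuous D.b :=
  continuous_iff_continuousAt.2 fun x => (D.hasDerivAt_b x).continuousAt

theorem continuous_diag : Continuous fun t => D.k t t :=
  D.continuous_k.comp (by fun_prop : Continuous fun t : ℝ => (t, t))

/-- The density, in the weight `(1 - t) ^ (n + 1)`, of the right-hand side of the differentiated
equation. -/
def source (d : ℝ → ℝ≥0∞) (t : ℝ) : ℝ≥0∞ :=
  ENNReal.ofReal ((1 - t) ^ (D.n + 1)) *
      (ENNReal.ofReal (D.σ t) + ∫⁻ y in Ioo 0 t, ENNReal.ofReal (D.p t y) * d y) +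
    ENNReal.ofReal ((D.n + 1) * (1 - t) ^ D.n * D.b t - (1 - t) ^ (D.n + 1) * D.k t t) * d t

/-- The monotone operator whose least fixed point solves the equation. -/
def operator : (ℝ → ℝ≥0∞) →o (ℝ → ℝ≥0∞) where
  toFun d := (Ico (0 : ℝ) 1).indicator fun x =>
    ENNReal.ofReal (D.b x * (1 - x) ^ (D.n + 1))⁻¹ * ∫⁻ t in Ioo x 1, D.source d t
  monotone' d d' h x := by
    refine indicator_le_indicator ?_
    unfold source
    gcongr <;> apply h

theorem operator_apply {x : ℝ} (hx : x ∈ Ico (0 : ℝ) 1) (d : ℝ → ℝ≥0∞) : D.operator d x =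
    ENNReal.ofReal (D.b x * (1 - x) ^ (D.n + 1))⁻¹ * ∫⁻ t in Ioo x 1, D.source d t :=
  by simp [operator, hx]

theorem weight_nonneg {t : ℝ} (ht : t ∈ Ico (0 : ℝ) 1) :
    0 ≤ (D.n + 1) * (1 - t) ^ D.n * D.b t - (1 - t) ^ (D.n + 1) * D.k t t := by
  have := mul_le_mul_of_nonneg_left (D.diag_le t ht) (pow_nonneg (sub_nonneg.2 ht.2.le) D.n)
  rw [pow_succ]
  linarith

theorem source_half_le {t : ℝ} (ht : t ∈ Ioo (0 : ℝ) 1) :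
    D.source (fun _ => ENNReal.ofReal (1 / 2)) t ≤ ENNReal.ofReal
      (((D.n + 1) * (1 - t) ^ D.n * D.b t + (1 - t) ^ (D.n + 1) * D.β t) / 2) := by
  have ht0 : t ∈ Ico (0 : ℝ) 1 := ⟨ht.1.le, ht.2⟩
  have h1 : 0 ≤ (1 - t) ^ (D.n + 1) := pow_nonneg (sub_nonneg.2 ht.2.le) _
  have hpm : Measurable (D.p t) := D.measurable_p.comp (by fun_prop : Measurable fun y => (t, y))
  have hint : ∫⁻ y in Ioo 0 t, ENNReal.ofReal (D.p t y) * ENNReal.ofReal (1 / 2) =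
      ENNReal.ofReal ((∫ y in 0..t, D.p t y) / 2) := by
    rw [lintegral_mul_const _ hpm.ennreal_ofReal, intervalIntegral.integral_of_le ht.1.le,
      integral_Ioc_eq_integral_Ioo, ← ofReal_integral_eq_lintegral_ofReal,
      ← ENNReal.ofReal_mul (integral_nonneg (D.p_nonneg t))]
    · ring_nf
    · refine Measure.integrableOn_of_bounded (M := D.bound) (by simp)
        hpm.aestronglyMeasurable (ae_of_all _ fun y => ?_)
      rw [Real.norm_of_nonneg (D.p_nonneg t y)]
      exact D.p_le t y
    · exact ae_of_all _ (D.p_nonneg t)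
  have hI : 0 ≤ ∫ y in 0..t, D.p t y :=
    intervalIntegral.integral_nonneg_of_forall ht.1.le (D.p_nonneg t)
  rw [source, hint, ← ENNReal.ofReal_add (D.σ_nonneg t ⟨ht.1.le, ht.2.le⟩) (by positivity),
    ← ENNReal.ofReal_mul h1, ← ENNReal.ofReal_mul (D.weight_nonneg ht0), ← ENNReal.ofReal_add]
  · apply ENNReal.ofReal_le_ofReal
    have := mul_le_mul_of_nonneg_left (D.half_supersolution t ht) h1
    linarith
  · exact mul_nonneg h1 (add_nonneg (D.σ_nonneg t ⟨ht.1.le, ht.2.le⟩) (by positivity))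
  · exact mul_nonneg (D.weight_nonneg ht0) (by norm_num)

/-- The integrand is minus the derivative of half the weighted `b`, which vanishes at `1`. Dividing
by `b x * (1 - x) ^ (n + 1)` gives exactly the constant `1/2` in `operator_half_le`. -/
theorem integral_weight_b (x : ℝ) :
    ∫ t in x..1, ((D.n + 1) * (1 - t) ^ D.n * D.b t + (1 - t) ^ (D.n + 1) * D.β t) / 2 =
      D.b x * (1 - x) ^ (D.n + 1) / 2 := by
  have hd (t : ℝ) : HasDerivAt (fun t => -(D.b t * (1 - t) ^ (D.n + 1) / 2))
      (((D.n + 1) * (1 - t) ^ D.n * D.b t + (1 - t) ^ (D.n + 1) * D.β t) / 2) t := by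
    have h := (((D.hasDerivAt_b t).mul
      (((hasDerivAt_id t).const_sub 1).pow (D.n + 1))).div_const 2).neg
    refine h.congr_deriv ?_
    simp only [Nat.add_sub_cancel, Pi.pow_apply, id]
    push_cast
    ring
  have := D.continuous_b
  have := D.continuous_β
  rw [intervalIntegral.integral_eq_sub_of_hasDerivAt (fun t _ => hd t)
    (Continuous.intervalIntegrable (by fun_prop) _ _)]
  simp

theorem operator_half_le :
    D.operator (fun _ => ENNReal.ofReal (1 / 2)) ≤ fun _ => ENNReal.ofReal (1 / 2) := by
  intro x
  by_cases hx : x ∈ Ico (0 : ℝ) 1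
  swap
  · simp [operator, hx]
  rw [D.operator_apply hx]
  have hpos : 0 < D.b x * (1 - x) ^ (D.n + 1) :=
    mul_pos (D.b_pos x hx) (pow_pos (sub_pos.2 hx.2) _)
  have hβb (t : ℝ) (ht : t ∈ Ioo x 1) :
      0 ≤ ((D.n + 1) * (1 - t) ^ D.n * D.b t + (1 - t) ^ (D.n + 1) * D.β t) / 2 := by
    have ht' : t ∈ Ioo (0 : ℝ) 1 := ⟨hx.1.trans_lt ht.1, ht.2⟩
    have h1 : 0 ≤ (1 - t) ^ (D.n + 1) := pow_nonneg (sub_nonneg.2 ht.2.le) _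
    have h2 := mul_le_mul_of_nonneg_left (D.half_supersolution t ht') h1
    have h3 := D.weight_nonneg ⟨ht'.1.le, ht'.2⟩
    have h4 : 0 ≤ (1 - t) ^ (D.n + 1) * (D.σ t + (∫ y in 0..t, D.p t y) / 2) := by
      have := D.σ_nonneg t ⟨ht'.1.le, ht'.2.le⟩
      have : 0 ≤ ∫ y in 0..t, D.p t y :=
        intervalIntegral.integral_nonneg_of_forall ht'.1.le (D.p_nonneg t)
      positivity
    linarith
  have hb := D.continuous_b
  have hβ := D.continuous_β
  calc ENNReal.ofReal (D.b x * (1 - x) ^ (D.n + 1))⁻¹ *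
        ∫⁻ t in Ioo x 1, D.source (fun _ => ENNReal.ofReal (1 / 2)) t
      ≤ ENNReal.ofReal (D.b x * (1 - x) ^ (D.n + 1))⁻¹ * ∫⁻ t in Ioo x 1, ENNReal.ofReal
          (((D.n + 1) * (1 - t) ^ D.n * D.b t + (1 - t) ^ (D.n + 1) * D.β t) / 2) := by
        gcongr 1
        exact setLIntegral_mono' measurableSet_Ioo fun t ht =>
          D.source_half_le ⟨hx.1.trans_lt ht.1, ht.2⟩
    _ = ENNReal.ofReal (1 / 2) := by
        rw [← ofReal_integral_eq_lintegral_ofReal, ← integral_Ioc_eq_integral_Ioo,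
          ← intervalIntegral.integral_of_le hx.2.le, D.integral_weight_b x,
          ← ENNReal.ofReal_mul (by positivity)]
        · congr 1
          rw [mul_div_assoc', inv_mul_cancel₀ hpos.ne']
        · have hc : Continuous fun t : ℝ =>
            (((D.n + 1) * (1 - t) ^ D.n * D.b t + (1 - t) ^ (D.n + 1) * D.β t) / 2) := by
              fun_prop
          exact hc.integrableOn_Icc.mono_set Ioo_subset_Icc_self
        · exact (ae_restrict_iff' measurableSet_Ioo).2 (ae_of_all _ hβb)

/-- The least solution, with values in `[0, ∞]`. -/
def leastSolution : ℝ → ℝ≥0∞ := D.operator.lfp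

/-- The least solution of the equation. -/
def solution (x : ℝ) : ℝ := (D.leastSolution x).toReal

theorem leastSolution_le (x : ℝ) : D.leastSolution x ≤ ENNReal.ofReal (1 / 2) :=
  D.operator.lfp_le D.operator_half_le x

theorem operator_leastSolution : D.operator D.leastSolution = D.leastSolution :=
  D.operator.map_lfp

/-- The lattice in which the fixed point is taken contains nonmeasurable functions. Values of the
operator are nevertheless measurable, whatever its argument, because a tail integral is antitone in
its lower end. -/
theorem measurable_leastSolution : Measurable D.leastSolution := by
  rw [← operator_leastSolution]
  refine Measurable.indicator (Measurable.mul ?_ ?_) measurableSet_Ico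
  · have := D.continuous_b.measurable
    fun_prop
  · refine Antitone.measurable fun x y hxy => lintegral_mono_set (Ioo_subset_Ioo_left hxy)

theorem measurable_solution : Measurable D.solution := D.measurable_leastSolution.ennreal_toReal

theorem solution_nonneg (x : ℝ) : 0 ≤ D.solution x := ENNReal.toReal_nonneg

theorem solution_le (x : ℝ) : D.solution x ≤ 1 / 2 := by
  have := ENNReal.toReal_mono ENNReal.ofReal_ne_top (D.leastSolution_le x)
  rwa [ENNReal.toReal_ofReal (by norm_num)] at this

theorem ofReal_solution (x : ℝ) : ENNReal.ofReal (D.solution x) = D.leastSolution x :=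
  ENNReal.ofReal_toReal (ne_top_of_le_ne_top ENNReal.ofReal_ne_top (D.leastSolution_le x))

theorem ofReal_mul_leastSolution {x : ℝ} (hx : x ∈ Ico (0 : ℝ) 1) :
    ENNReal.ofReal (D.b x * (1 - x) ^ (D.n + 1)) * D.leastSolution x =
      ∫⁻ t in Ioo x 1, D.source D.leastSolution t := by
  have hpos : 0 < D.b x * (1 - x) ^ (D.n + 1) :=
    mul_pos (D.b_pos x hx) (pow_pos (sub_pos.2 hx.2) _)
  conv_lhs => rw [← operator_leastSolution]
  rw [D.operator_apply hx, ← mul_assoc, ← ENNReal.ofReal_mul hpos.le,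
    mul_inv_cancel₀ hpos.ne', ENNReal.ofReal_one, one_mul]

theorem measurable_lintegral_p {d : ℝ → ℝ≥0∞} (hd : Measurable d) :
    Measurable fun t => ∫⁻ y in Ioo 0 t, ENNReal.ofReal (D.p t y) * d y := by
  have hp := D.measurable_p
  have h : Measurable fun x : ℝ × ℝ => {x : ℝ × ℝ | 0 < x.2 ∧ x.2 < x.1}.indicator
      (fun x => ENNReal.ofReal (Function.uncurry D.p x) * d x.2) x := by
    refine Measurable.indicator (by fun_prop) ?_
    exact (measurableSet_lt measurable_const measurable_snd).inter
      (measurableSet_lt measurable_snd measurable_fst)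
  convert h.lintegral_prod_right' (ν := volume) using 2 with t
  rw [← lintegral_indicator measurableSet_Ioo]
  rfl

theorem measurable_source {d : ℝ → ℝ≥0∞} (hd : Measurable d) : Measurable (D.source d) := by
  have h1 := D.measurable_lintegral_p hd
  have h2 := D.continuous_b.measurable
  have h3 := D.continuous_σ.measurable
  have h4 := D.continuous_diag.measurable
  unfold source
  fun_prop

/-- At a zero of the solution the whole tail integral of the nonnegative source vanishes, so each of
its terms vanishes almost everywhere to the right. Both positivity proofs contradict this. -/
theorem vanishing_of_solution_eq_zero {x : ℝ} (hx : x ∈ Ico (0 : ℝ) 1) (h : D.solution x = 0) :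
    (∀ᵐ t, t ∈ Ioo x 1 → D.σ t = 0 ∧ ∀ᵐ y, y ∈ Ioo 0 t → D.p t y * D.solution y = 0) ∧
      ∀ t ∈ Ico x 1, D.solution t = 0 := by
  have h0 : ∫⁻ t in Ioo x 1, D.source D.leastSolution t = 0 := by
    rw [← D.ofReal_mul_leastSolution hx, ← ofReal_solution, h]
    simp
  constructor
  · have h1 := (setLIntegral_eq_zero_iff measurableSet_Ioo
      (D.measurable_source D.measurable_leastSolution)).1 h0
    filter_upwards [h1] with t ht htx
    have ht0 : t ∈ Ioo (0 : ℝ) 1 := ⟨hx.1.trans_lt htx.1, htx.2⟩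
    have hw : ENNReal.ofReal ((1 - t) ^ (D.n + 1)) ≠ 0 := by
      have : 0 < (1 - t) ^ (D.n + 1) := pow_pos (sub_pos.2 htx.2) _
      simpa using this
    have h2 := (add_eq_zero.1 ((mul_eq_zero.1 (add_eq_zero.1 (ht htx)).1).resolve_left hw))
    refine ⟨le_antisymm (ENNReal.ofReal_eq_zero.1 h2.1) (D.σ_nonneg t ⟨ht0.1.le, ht0.2.le⟩), ?_⟩
    have hpm : Measurable (D.p t) := D.measurable_p.comp (by fun_prop : Measurable fun y => (t, y))
    have h3 := (setLIntegral_eq_zero_iff measurableSet_Ioo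
      (hpm.ennreal_ofReal.mul D.measurable_leastSolution)).1 h2.2
    filter_upwards [h3] with y hy hyt
    rcases mul_eq_zero.1 (hy hyt) with h4 | h4
    · rw [le_antisymm (ENNReal.ofReal_eq_zero.1 h4) (D.p_nonneg t y), zero_mul]
    · rw [solution, h4, ENNReal.toReal_zero, mul_zero]
  · intro t ht
    have h1 : ∫⁻ t in Ioo t 1, D.source D.leastSolution t = 0 :=
      le_antisymm ((lintegral_mono_set (Ioo_subset_Ioo_left ht.1)).trans h0.le) zero_le
    have ht' : t ∈ Ico (0 : ℝ) 1 := ⟨hx.1.trans ht.1, ht.2⟩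
    have hpos : 0 < D.b t * (1 - t) ^ (D.n + 1) :=
      mul_pos (D.b_pos t ht') (pow_pos (sub_pos.2 ht.2) _)
    rw [← D.ofReal_mul_leastSolution ht', mul_eq_zero, ← ofReal_solution] at h1
    rcases h1 with h1 | h1
    · exact absurd (ENNReal.ofReal_eq_zero.1 h1) (not_le.2 hpos)
    · exact le_antisymm (ENNReal.ofReal_eq_zero.1 h1) (D.solution_nonneg t)

/-- Tonelli's theorem on a triangle. -/
theorem _root_.JudgeGame.lintegral_triangle {f g : ℝ → ℝ≥0∞} (hf : Measurable f)
    (hg : Measurable g) (x z : ℝ) :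
    ∫⁻ t in Ioo x z, f t * ∫⁻ u in Ioo t z, g u = ∫⁻ u in Ioo x z, g u * ∫⁻ t in Ioo x u, f t := by
  have hm : Measurable (Function.uncurry fun t u : ℝ =>
      {x : ℝ × ℝ | x.1 < x.2}.indicator (fun x => f x.1 * g x.2) (t, u)) := by
    exact Measurable.indicator (f := fun x : ℝ × ℝ => f x.1 * g x.2) (by fun_prop)
      (measurableSet_lt measurable_fst measurable_snd)
  trans ∫⁻ t in Ioo x z, ∫⁻ u in Ioo x z,
      {x : ℝ × ℝ | x.1 < x.2}.indicator (fun x => f x.1 * g x.2) (t, u)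
  · refine setLIntegral_congr_fun measurableSet_Ioo fun t ht => ?_
    rw [← lintegral_const_mul _ hg, ← lintegral_indicator measurableSet_Ioo,
      ← lintegral_indicator measurableSet_Ioo]
    refine lintegral_congr fun u => ?_
    simp only [indicator, mem_Ioo, mem_ofPred_eq]
    have := ht.1
    split_ifs <;> first | rfl | (exfalso; grind)
  rw [lintegral_lintegral_swap hm.aemeasurable]
  refine setLIntegral_congr_fun measurableSet_Ioo fun u hu => ?_
  rw [← lintegral_const_mul _ hf, ← lintegral_indicator measurableSet_Ioo,
    ← lintegral_indicator measurableSet_Ioo]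
  refine lintegral_congr fun t => ?_
  have := hu.2
  simp only [indicator, mem_Ioo, mem_ofPred_eq]
  split_ifs <;> first | rfl | (exfalso; grind) | exact mul_comm _ _

theorem lintegral_weight {x u : ℝ} (hxu : x ≤ u) (hu : u < 1) :
    ∫⁻ t in Ioo x u, ENNReal.ofReal ((D.n + 1) * ((1 - t) ^ (D.n + 2))⁻¹) =
      ENNReal.ofReal (((1 - u) ^ (D.n + 1))⁻¹ - ((1 - x) ^ (D.n + 1))⁻¹) := by
  have hne (t : ℝ) (ht : t ∈ uIcc x u) : 0 < 1 - t := by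
    rw [uIcc_of_le hxu] at ht
    linarith [ht.2]
  have hd (t : ℝ) (ht : t ∈ uIcc x u) : HasDerivAt (fun t => ((1 - t) ^ (D.n + 1))⁻¹)
      ((D.n + 1) * ((1 - t) ^ (D.n + 2))⁻¹) t := by
    have h := (((hasDerivAt_id t).const_sub 1).pow (D.n + 1)).inv (pow_pos (hne t ht) _).ne'
    refine h.congr_deriv ?_
    have := (hne t ht).ne'
    simp only [id, Nat.add_sub_cancel, Pi.pow_apply]
    push_cast
    field_simp
    ring
  have hc : ContinuousOn (fun t : ℝ => (D.n + 1) * ((1 - t) ^ (D.n + 2))⁻¹) (uIcc x u) := by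
    refine ContinuousOn.mul continuousOn_const (ContinuousOn.inv₀ (by fun_prop) fun t ht => ?_)
    exact (pow_pos (hne t ht) _).ne'
  rw [← ofReal_integral_eq_lintegral_ofReal, ← integral_Ioc_eq_integral_Ioo,
    ← intervalIntegral.integral_of_le hxu,
    intervalIntegral.integral_eq_sub_of_hasDerivAt hd hc.intervalIntegrable]
  · rw [uIcc_of_le hxu] at hc
    exact hc.integrableOn_Icc.mono_set Ioo_subset_Icc_self
  · refine (ae_restrict_iff' measurableSet_Ioo).2 (ae_of_all _ fun t ht => ?_)
    have := hne t (by rw [uIcc_of_le hxu]; exact ⟨ht.1.le, ht.2.le⟩)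
    simp only [Pi.zero_apply]
    positivity

/-- The differentiated equation without the weight, in integrated form. -/
theorem lintegral_source_div {x : ℝ} (hx : x ∈ Ico (0 : ℝ) 1) :
    ∫⁻ t in Ioo x 1, ENNReal.ofReal ((1 - t) ^ (D.n + 1))⁻¹ * D.source D.leastSolution t =
      ENNReal.ofReal (D.b x) * D.leastSolution x +
        ∫⁻ t in Ioo x 1, ENNReal.ofReal ((D.n + 1) * (D.b t / (1 - t))) * D.leastSolution t := by
  have hs := D.measurable_source D.measurable_leastSolution
  have h1x : 0 < 1 - x := sub_pos.2 hx.2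
  have e1 : ∫⁻ t in Ioo x 1, ENNReal.ofReal ((D.n + 1) * (D.b t / (1 - t))) * D.leastSolution t =
      ∫⁻ t in Ioo x 1, ENNReal.ofReal ((D.n + 1) * ((1 - t) ^ (D.n + 2))⁻¹) *
        ∫⁻ u in Ioo t 1, D.source D.leastSolution u := by
    refine setLIntegral_congr_fun measurableSet_Ioo fun t ht => ?_
    have h1t : 0 < 1 - t := sub_pos.2 ht.2
    rw [← D.ofReal_mul_leastSolution ⟨hx.1.trans ht.1.le, ht.2⟩, ← mul_assoc,
      ← ENNReal.ofReal_mul (by positivity)]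
    congr 2
    field_simp
    ring
  have e2 : ENNReal.ofReal (D.b x) * D.leastSolution x =
      ∫⁻ t in Ioo x 1, ENNReal.ofReal ((1 - x) ^ (D.n + 1))⁻¹ * D.source D.leastSolution t := by
    rw [lintegral_const_mul _ hs, ← D.ofReal_mul_leastSolution hx, ← mul_assoc,
      ← ENNReal.ofReal_mul (by positivity)]
    congr 2
    field_simp
  -- This is integration by parts against the weight, done by Tonelli: the inner integral of the
  -- derivative of `(1 - t) ^ (-(n + 1))` telescopes with the boundary term. Working in `[0, ∞]`
  -- needs no integrability near the singular end.
  rw [e1, e2, lintegral_triangle (by fun_prop) hs, ← lintegral_add_left (by fun_prop)]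
  refine setLIntegral_congr_fun measurableSet_Ioo fun t ht => ?_
  have h1t : 0 < 1 - t := sub_pos.2 ht.2
  rw [D.lintegral_weight ht.1.le ht.2, mul_comm (D.source _ _), ← add_mul,
    ← ENNReal.ofReal_add (by positivity)]
  · ring_nf
  · rw [sub_nonneg]
    have := ht.1.le
    gcongr

theorem measurable_p_left (t : ℝ) : Measurable (D.p t) :=
  D.measurable_p.comp (by fun_prop : Measurable fun y => (t, y))

theorem norm_p_mul_solution_le (t y : ℝ) : ‖D.p t y * D.solution y‖ ≤ D.bound * (1 / 2) := by
  rw [Real.norm_of_nonneg (mul_nonneg (D.p_nonneg t y) (D.solution_nonneg y))]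
  exact mul_le_mul (D.p_le t y) (D.solution_le y) (D.solution_nonneg y)
    ((D.p_nonneg t y).trans (D.p_le t y))

theorem ofReal_integral_p_mul_solution (t : ℝ) :
    ENNReal.ofReal (∫ y in Ioo 0 t, D.p t y * D.solution y) =
      ∫⁻ y in Ioo 0 t, ENNReal.ofReal (D.p t y) * D.leastSolution y := by
  have := D.measurable_p_left t
  have := D.measurable_solution
  rw [ofReal_integral_eq_lintegral_ofReal]
  · simp_rw [ENNReal.ofReal_mul (D.p_nonneg t _), ofReal_solution]
  · exact Measure.integrableOn_of_bounded (by simp)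
      (by fun_prop : Measurable fun y => D.p t y * D.solution y).aestronglyMeasurable
      (ae_of_all _ (D.norm_p_mul_solution_le t))
  · exact ae_of_all _ fun y => mul_nonneg (D.p_nonneg t y) (D.solution_nonneg y)

theorem integral_p_mul_solution_nonneg (t : ℝ) : 0 ≤ ∫ y in Ioo 0 t, D.p t y * D.solution y :=
  integral_nonneg fun y => mul_nonneg (D.p_nonneg t y) (D.solution_nonneg y)

theorem measurable_integral_p_mul_solution :
    Measurable fun t => ∫ y in Ioo 0 t, D.p t y * D.solution y := by
  convert (D.measurable_lintegral_p D.measurable_leastSolution).ennreal_toReal using 2 with t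
  rw [← ofReal_integral_p_mul_solution, ENNReal.toReal_ofReal (D.integral_p_mul_solution_nonneg t)]

theorem integrableOn_integral_p_mul_solution (x : ℝ) :
    IntegrableOn (fun t => ∫ y in Ioo 0 t, D.p t y * D.solution y) (Ioo x 1) := by
  refine Measure.integrableOn_of_bounded (M := D.bound * (1 / 2) * |1|) (by simp)
    D.measurable_integral_p_mul_solution.aestronglyMeasurable
    ((ae_restrict_iff' measurableSet_Ioo).2 (ae_of_all _ fun t ht => ?_))
  refine (norm_setIntegral_le_of_norm_le_const (by simp)
    fun y _ => D.norm_p_mul_solution_le t y).trans ?_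
  have : 0 ≤ D.bound := (D.p_nonneg 0 0).trans (D.p_le 0 0)
  gcongr
  simp only [measureReal_def, Real.volume_Ioo]
  rw [sub_zero, abs_one]
  exact ENNReal.toReal_le_of_le_ofReal zero_le_one (ENNReal.ofReal_le_ofReal ht.2.le)

theorem integrableOn_mul_solution {f : ℝ → ℝ} {s : Set ℝ} (hf : IntegrableOn f s) :
    IntegrableOn (fun t => f t * D.solution t) s := by
  refine Integrable.mul_bdd (c := 1 / 2) hf D.measurable_solution.aestronglyMeasurable
    (ae_of_all _ fun t => ?_)
  rw [Real.norm_of_nonneg (D.solution_nonneg t)]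
  exact D.solution_le t

/-- Since `b 1 = 0`, the quotient is minus a difference quotient of `b` at `1`, hence extends
continuously to `1`. -/
theorem integrableOn_b_div (x : ℝ) :
    IntegrableOn (fun t => (D.n + 1) * (D.b t / (1 - t))) (Ioo x 1) := by
  have hc : Continuous (dslope D.b 1) := by
    rw [← continuousOn_univ, continuousOn_dslope Filter.univ_mem]
    exact ⟨D.continuous_b.continuousOn, (D.hasDerivAt_b 1).differentiableAt⟩
  have h : IntegrableOn (fun t => (D.n + 1) * (-dslope D.b 1 t)) (Ioo x 1) :=
    (Continuous.integrableOn_Icc (by fun_prop)).mono_set Ioo_subset_Icc_self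
  refine h.congr_fun (fun t ht => ?_) measurableSet_Ioo
  simp only
  rw [dslope_of_ne _ ht.2.ne, slope_def_field, D.b_one, sub_zero, ← div_neg, neg_sub]

theorem integrableOn_diag (x : ℝ) : IntegrableOn (fun t => D.k t t) (Ioo x 1) :=
  D.continuous_diag.integrableOn_Icc.mono_set Ioo_subset_Icc_self

theorem integrableOn_σ (x : ℝ) : IntegrableOn D.σ (Ioo x 1) :=
  D.continuous_σ.integrableOn_Icc.mono_set Ioo_subset_Icc_self

/-- The auxiliary term `(n + 1) * (b t / (1 - t)) * d t` introduced by the weight appears on both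
sides of `lintegral_source_div`. It is integrable, so one may pass to real integrals and cancel it.
-/
theorem integral_source_eq {x : ℝ} (hx : x ∈ Ico (0 : ℝ) 1) :
    (∫ t in Ioo x 1, D.σ t) + ∫ t in Ioo x 1, ∫ y in Ioo 0 t, D.p t y * D.solution y =
      D.b x * D.solution x + ∫ t in Ioo x 1, D.k t t * D.solution t := by
  have hlam := D.integrableOn_mul_solution (D.integrableOn_b_div x)
  have hk := D.integrableOn_mul_solution (D.integrableOn_diag x)
  have hI := D.integrableOn_integral_p_mul_solution x
  have hσ := D.integrableOn_σ x
  have hlam0 : 0 ≤ᵐ[volume.restrict (Ioo x 1)]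
      fun t => (D.n + 1) * (D.b t / (1 - t)) * D.solution t := by
    refine (ae_restrict_iff' measurableSet_Ioo).2 (ae_of_all _ fun t ht => ?_)
    have h1t : 0 < 1 - t := sub_pos.2 ht.2
    have := D.b_pos t ⟨hx.1.trans ht.1.le, ht.2⟩
    have := D.solution_nonneg t
    simp only [Pi.zero_apply]
    positivity
  have hdiff (t : ℝ) (ht : t ∈ Ioo x 1) : D.k t t ≤ (D.n + 1) * (D.b t / (1 - t)) := by
    have := D.diag_le t ⟨hx.1.trans ht.1.le, ht.2⟩
    rw [mul_div_assoc', le_div_iff₀ (sub_pos.2 ht.2)]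
    linarith
  have hL0 (t : ℝ) (ht : t ∈ Ioo x 1) :
      0 ≤ D.σ t + (∫ y in Ioo 0 t, D.p t y * D.solution y) :=
    add_nonneg (D.σ_nonneg t ⟨hx.1.trans ht.1.le, ht.2.le⟩) (D.integral_p_mul_solution_nonneg t)
  have key := D.lintegral_source_div hx
  have eL : ∫⁻ t in Ioo x 1, ENNReal.ofReal ((1 - t) ^ (D.n + 1))⁻¹ * D.source D.leastSolution t =
      ENNReal.ofReal (∫ t in Ioo x 1, (D.σ t + (∫ y in Ioo 0 t, D.p t y * D.solution y) +
        ((D.n + 1) * (D.b t / (1 - t)) * D.solution t - D.k t t * D.solution t))) := by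
    rw [ofReal_integral_eq_lintegral_ofReal]
    · refine setLIntegral_congr_fun measurableSet_Ioo fun t ht => ?_
      have h1t : 0 < 1 - t := sub_pos.2 ht.2
      have ht0 : t ∈ Ico (0 : ℝ) 1 := ⟨hx.1.trans ht.1.le, ht.2⟩
      rw [source, ← ofReal_solution, ← ofReal_integral_p_mul_solution,
        ← ENNReal.ofReal_add (D.σ_nonneg t ⟨ht0.1, ht0.2.le⟩) (D.integral_p_mul_solution_nonneg t),
        ← ENNReal.ofReal_mul (by positivity), ← ENNReal.ofReal_mul (D.weight_nonneg ht0),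
        ← ENNReal.ofReal_add (mul_nonneg (by positivity) (hL0 t ht))
          (mul_nonneg (D.weight_nonneg ht0) (D.solution_nonneg t)),
        ← ENNReal.ofReal_mul (by positivity)]
      congr 1
      rw [pow_succ]
      field_simp
    · exact (hσ.add hI).add (hlam.sub hk)
    · refine (ae_restrict_iff' measurableSet_Ioo).2 (ae_of_all _ fun t ht => ?_)
      have := mul_le_mul_of_nonneg_right (hdiff t ht) (D.solution_nonneg t)
      exact add_nonneg (hL0 t ht) (sub_nonneg.2 this)
  have eR : ∫⁻ t in Ioo x 1, ENNReal.ofReal ((D.n + 1) * (D.b t / (1 - t))) * D.leastSolution t =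
      ENNReal.ofReal (∫ t in Ioo x 1, (D.n + 1) * (D.b t / (1 - t)) * D.solution t) := by
    rw [ofReal_integral_eq_lintegral_ofReal hlam hlam0]
    refine setLIntegral_congr_fun measurableSet_Ioo fun t ht => ?_
    have h1t : 0 < 1 - t := sub_pos.2 ht.2
    have := D.b_pos t ⟨hx.1.trans ht.1.le, ht.2⟩
    rw [ENNReal.ofReal_mul (p := (D.n + 1) * (D.b t / (1 - t))) (by positivity), ofReal_solution]
  have hb0 := mul_nonneg (D.b_pos x hx).le (D.solution_nonneg x)
  have hLam0 := integral_nonneg_of_ae hlam0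
  rw [eL, eR, ← ofReal_solution, ← ENNReal.ofReal_mul (D.b_pos x hx).le,
    ← ENNReal.ofReal_add hb0 hLam0, ENNReal.ofReal_eq_ofReal_iff _ (add_nonneg hb0 hLam0)] at key
  · have e1 := integral_add (hσ.add hI) (hlam.sub hk)
    have e2 := integral_sub hlam hk
    have e3 := integral_add hσ hI
    simp only [Pi.add_apply, Pi.sub_apply] at e1 e2 e3
    linarith
  · refine setIntegral_nonneg measurableSet_Ioo fun t ht => ?_
    have := mul_le_mul_of_nonneg_right (hdiff t ht) (D.solution_nonneg t)
    exact add_nonneg (hL0 t ht) (sub_nonneg.2 this)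

theorem integrableOn_k_mul_solution (x : ℝ) (s : Set ℝ) (hs : s ⊆ Icc 0 1) :
    IntegrableOn (fun y => D.k x y * D.solution y) s := by
  have hc : Continuous fun y => D.k x y :=
    D.continuous_k.comp (by fun_prop : Continuous fun y : ℝ => (x, y))
  exact D.integrableOn_mul_solution (hc.integrableOn_Icc.mono_set hs)

/-- Fubini undoes the differentiation of the kernel. For fixed `y`, the variable `t` runs from `max
x y` to `1`, which leaves `k (max x y) y - k 1 y`; splitting at `y = x` gives the off-diagonal and
the diagonal term. -/
theorem integral_integral_p_mul_solution {x : ℝ} (hx : x ∈ Ico (0 : ℝ) 1) :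
    ∫ t in Ioo x 1, ∫ y in Ioo 0 t, D.p t y * D.solution y =
      (∫ y in Ioo 0 x, D.k x y * D.solution y) + (∫ y in Ioo x 1, D.k y y * D.solution y) -
        ∫ y in Ioo 0 1, D.k 1 y * D.solution y := by
  have hd := D.measurable_solution
  have hp := D.measurable_p
  let F : ℝ → ℝ → ℝ := fun t y => {z : ℝ × ℝ | z.2 < z.1}.indicator
    (fun z => Function.uncurry D.p z * D.solution z.2) (t, y)
  have hF : Measurable (Function.uncurry F) :=
    Measurable.indicator (f := fun z : ℝ × ℝ => Function.uncurry D.p z * D.solution z.2)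
      (by fun_prop) (measurableSet_lt measurable_snd measurable_fst)
  have hFb : Integrable (Function.uncurry F)
      ((volume.restrict (Ioo x 1)).prod (volume.restrict (Ioo 0 1))) := by
    refine Integrable.of_bound hF.aestronglyMeasurable (D.bound * (1 / 2)) (ae_of_all _ fun z => ?_)
    refine (norm_indicator_le_norm_self
      (fun z : ℝ × ℝ => Function.uncurry D.p z * D.solution z.2) z).trans ?_
    exact D.norm_p_mul_solution_le z.1 z.2
  trans ∫ t in Ioo x 1, ∫ y in Ioo 0 1, F t y
  · refine setIntegral_congr_fun measurableSet_Ioo fun t ht => ?_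
    rw [← integral_indicator measurableSet_Ioo, ← integral_indicator measurableSet_Ioo]
    refine integral_congr_ae (ae_of_all _ fun y => ?_)
    have := ht.2
    simp only [F, indicator, mem_Ioo, mem_ofPred_eq, Function.uncurry]
    split_ifs <;> first | rfl | (exfalso; grind)
  rw [integral_integral_swap hFb]
  have inner (y : ℝ) (hy : y ∈ Ioo (0 : ℝ) 1) : ∫ t in Ioo x 1, F t y =
      (D.k (max x y) y - D.k 1 y) * D.solution y := by
    have hm : max x y < 1 := max_lt hx.2 hy.2
    rw [← D.integral_p _ _ hy.1.le (le_max_right _ _) hm.le,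
      intervalIntegral.integral_of_le hm.le, integral_Ioc_eq_integral_Ioo,
      ← integral_mul_const, ← integral_indicator measurableSet_Ioo,
      ← integral_indicator measurableSet_Ioo]
    refine integral_congr_ae (ae_of_all _ fun t => ?_)
    simp only [F, indicator, mem_Ioo, mem_ofPred_eq, Function.uncurry, max_lt_iff]
    split_ifs <;> first | rfl | (exfalso; grind)
  rw [setIntegral_congr_fun measurableSet_Ioo inner]
  have hk1 := D.integrableOn_k_mul_solution 1 _ Ioo_subset_Icc_self
  have hdi : IntegrableOn (fun y => D.k (max x y) y * D.solution y) (Ioo 0 1) := by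
    have hc : Continuous fun y => D.k (max x y) y :=
      D.continuous_k.comp (by fun_prop : Continuous fun y : ℝ => (max x y, y))
    exact D.integrableOn_mul_solution (hc.integrableOn_Icc.mono_set Ioo_subset_Icc_self)
  simp_rw [sub_mul]
  rw [integral_sub hdi hk1]
  congr 1
  rw [← integral_Ioc_eq_integral_Ioo, ← Ioc_union_Ioc_eq_Ioc hx.1 hx.2.le, setIntegral_union
    (Ioc_disjoint_Ioc_of_le le_rfl) measurableSet_Ioc, ← integral_Ioc_eq_integral_Ioo,
    ← integral_Ioc_eq_integral_Ioo]
  · congr 1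
    · refine setIntegral_congr_fun measurableSet_Ioc fun y hy => ?_
      simp only [max_eq_left hy.2]
    · refine setIntegral_congr_fun measurableSet_Ioc fun y hy => ?_
      simp only [max_eq_right hy.1.le]
  · rw [integrableOn_Ioc_iff_integrableOn_Ioo]
    exact hdi.mono_set (Ioo_subset_Ioo_right hx.2.le)
  · rw [integrableOn_Ioc_iff_integrableOn_Ioo]
    exact hdi.mono_set (Ioo_subset_Ioo_left hx.1)

theorem solution_spec {x : ℝ} (hx : x ∈ Icc (0 : ℝ) 1) :
    D.b x * D.solution x = (∫ t in x..1, D.σ t) + (∫ y in 0..x, D.k x y * D.solution y) -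
      ∫ y in 0..1, D.k 1 y * D.solution y := by
  rcases hx.2.eq_or_lt with rfl | h1
  -- At `1` both sides are zero because the constant is the kernel integral at `x = 1`.
  · simp [D.b_one]
  have hx' : x ∈ Ico (0 : ℝ) 1 := ⟨hx.1, h1⟩
  have e1 := D.integral_source_eq hx'
  have e2 := D.integral_integral_p_mul_solution hx'
  rw [intervalIntegral.integral_of_le hx.1, intervalIntegral.integral_of_le hx.2,
    intervalIntegral.integral_of_le zero_le_one, integral_Ioc_eq_integral_Ioo,
    integral_Ioc_eq_integral_Ioo, integral_Ioc_eq_integral_Ioo]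
  linarith

end EquationData

theorem exists_mem_Ioo_of_ae {P : ℝ → Prop} (h : ∀ᵐ t, P t) {a b : ℝ} (hab : a < b) :
    ∃ t ∈ Ioo a b, P t := by
  have h1 : ∃ᵐ t, t ∈ Ioo a b := by
    rw [frequently_ae_mem_iff]
    simp [hab]
  obtain ⟨t, ht, hP⟩ := (h1.and_eventually h).exists
  exact ⟨t, ht, hP⟩

/-! ### The overlap function and its primitive. -/

/-- The probability that a message at distance `t` from the state is consistent. -/
def overlap (ε t : ℝ) : ℝ := max 0 (1 - |t| / (2 * ε))

section overlap

variable {ε : ℝ}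

theorem continuous_overlap : Continuous (overlap ε) := by
  unfold overlap
  fun_prop

theorem overlap_nonneg (t : ℝ) : 0 ≤ overlap ε t := le_max_left _ _

theorem overlap_le_one (hε : 0 < ε) (t : ℝ) : overlap ε t ≤ 1 := by
  have : 0 ≤ |t| / (2 * ε) := by positivity
  exact max_le zero_le_one (by linarith)

@[simp] theorem overlap_neg (t : ℝ) : overlap ε (-t) = overlap ε t := by simp [overlap]

@[simp] theorem overlap_zero : overlap ε 0 = 1 := by simp [overlap]

theorem overlap_sub_comm (x y : ℝ) : overlap ε (x - y) = overlap ε (y - x) := by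
  rw [← neg_sub, overlap_neg]

theorem overlap_le_overlap (hε : 0 < ε) {s t : ℝ} (h : |s| ≤ |t|) :
    overlap ε t ≤ overlap ε s := by
  unfold overlap
  gcongr

theorem overlap_of_le (hε : 0 < ε) {t : ℝ} (ht : 2 * ε ≤ |t|) : overlap ε t = 0 := by
  have : 1 ≤ |t| / (2 * ε) := (one_le_div (by positivity)).2 ht
  exact max_eq_left (by linarith)

theorem overlap_of_abs_le (hε : 0 < ε) {t : ℝ} (ht : |t| ≤ 2 * ε) :
    overlap ε t = 1 - |t| / (2 * ε) := by
  have : |t| / (2 * ε) ≤ 1 := (div_le_one (by positivity)).2 ht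
  exact max_eq_right (by linarith)

theorem overlap_lt_overlap (hε : 0 < ε) {s t : ℝ} (h : |s| < |t|) (hs : |s| < 2 * ε) :
    overlap ε t < overlap ε s := by
  rw [overlap_of_abs_le hε hs.le]
  have h1 : |s| / (2 * ε) < 1 := (div_lt_one (by positivity)).2 hs
  have h2 : |s| / (2 * ε) < |t| / (2 * ε) := by gcongr
  exact max_lt (by linarith) (by linarith)

/-- Minus the derivative of `overlap ε` on the positive half line. -/
def overlapRate (ε t : ℝ) : ℝ := if t < 2 * ε then (2 * ε)⁻¹ else 0

theorem measurable_overlapRate : Measurable (overlapRate ε) :=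
  Measurable.ite measurableSet_Iio measurable_const measurable_const

theorem overlapRate_nonneg (hε : 0 < ε) (t : ℝ) : 0 ≤ overlapRate ε t := by
  unfold overlapRate
  split_ifs <;> positivity

theorem overlapRate_le (hε : 0 < ε) (t : ℝ) : overlapRate ε t ≤ (2 * ε)⁻¹ := by
  unfold overlapRate
  split_ifs
  · rfl
  · positivity

theorem antitone_overlapRate (hε : 0 < ε) : Antitone (overlapRate ε) := by
  intro s t h
  unfold overlapRate
  split_ifs
  · rfl
  · linarith
  · positivity
  · rfl

theorem integral_overlapRate (hε : 0 < ε) {u v : ℝ} (hu : 0 ≤ u) (huv : u ≤ v) :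
    ∫ t in u..v, overlapRate ε t = overlap ε u - overlap ε v := by
  refine (integral_eq_of_hasDerivAt_off_countable
    (fun t => -overlap ε t) _ (s := {0, 2 * ε}) (Set.toFinite _).countable
    continuous_overlap.neg.continuousOn ?_ ?_).trans (by ring)
  · rintro t ⟨ht, hts⟩
    rw [min_eq_left huv, max_eq_right huv] at ht
    simp only [mem_insert_iff, mem_singleton_iff, not_or] at hts
    have ht0 : 0 < t := hu.trans_lt ht.1
    rcases lt_or_gt_of_ne hts.2 with h | h
    · have h1 : HasDerivAt (fun t => -(1 - t / (2 * ε))) (overlapRate ε t) t := by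
        have := (((hasDerivAt_id t).div_const (2 * ε)).const_sub 1).neg
        refine this.congr_deriv ?_
        simp [overlapRate, h]
      refine h1.congr_of_eventuallyEq ?_
      filter_upwards [Ioo_mem_nhds ht0 h] with s hs
      rw [overlap_of_abs_le hε (by rw [abs_of_pos hs.1]; exact hs.2.le), abs_of_pos hs.1]
    · have h1 : HasDerivAt (fun _ : ℝ => (0 : ℝ)) (overlapRate ε t) t := by
        rw [overlapRate, if_neg h.not_gt]
        exact hasDerivAt_const _ _
      refine h1.congr_of_eventuallyEq ?_
      filter_upwards [Ioi_mem_nhds h, Ioi_mem_nhds ht0] with s hs hs0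
      rw [overlap_of_le hε (by rw [abs_of_pos hs0]; exact (mem_Ioi.1 hs).le), neg_zero]
  · exact (antitone_overlapRate hε).intervalIntegrable

theorem intervalIntegrable_overlapRate_comp (hε : 0 < ε) {f : ℝ → ℝ} (hf : Measurable f)
    (u v : ℝ) : IntervalIntegrable (fun t => overlapRate ε (f t)) volume u v := by
  rw [intervalIntegrable_iff]
  refine Measure.integrableOn_of_bounded (M := (2 * ε)⁻¹) (by simp)
    (measurable_overlapRate.comp hf).aestronglyMeasurable (ae_of_all _ fun t => ?_)
  rw [Real.norm_of_nonneg (overlapRate_nonneg hε _)]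
  exact overlapRate_le hε _

/-- The primitive of `overlap ε`. -/
def cumOverlap (ε u : ℝ) : ℝ := ∫ t in 0..u, overlap ε t

theorem hasDerivAt_cumOverlap (u : ℝ) : HasDerivAt (cumOverlap ε) (overlap ε u) u :=
  intervalIntegral.integral_hasDerivAt_right (continuous_overlap.intervalIntegrable _ _)
    (continuous_overlap.stronglyMeasurableAtFilter _ _) continuous_overlap.continuousAt

theorem continuous_cumOverlap : Continuous (cumOverlap ε) :=
  continuous_iff_continuousAt.2 fun u => (hasDerivAt_cumOverlap u).continuousAt

theorem integral_overlap (u v : ℝ) :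
    ∫ t in u..v, overlap ε t = cumOverlap ε v - cumOverlap ε u :=
  (intervalIntegral.integral_interval_sub_left (continuous_overlap.intervalIntegrable _ _)
    (continuous_overlap.intervalIntegrable _ _)).symm

@[simp] theorem cumOverlap_zero : cumOverlap ε 0 = 0 := by simp [cumOverlap]

theorem monotone_cumOverlap : Monotone (cumOverlap ε) := fun u v h => by
  rw [← sub_nonneg, ← integral_overlap]
  exact intervalIntegral.integral_nonneg_of_forall h overlap_nonneg

theorem cumOverlap_lt (hε : 0 < ε) {u v : ℝ} (hu : 0 ≤ u) (huv : u < v) (hu2 : u < 2 * ε) :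
    cumOverlap ε u < cumOverlap ε v := by
  rw [← sub_pos, ← integral_overlap]
  refine intervalIntegral.integral_pos huv continuous_overlap.continuousOn
    (fun t _ => overlap_nonneg t) ⟨u, ⟨le_rfl, huv.le⟩, ?_⟩
  have := overlap_lt_overlap hε (s := u) (t := 2 * ε)
    (by rwa [abs_of_nonneg hu, abs_of_pos (by positivity)]) (by rwa [abs_of_nonneg hu])
  exact (overlap_nonneg _).trans_lt this

theorem cumOverlap_of_le (hε : 0 < ε) {u : ℝ} (hu : 2 * ε ≤ u) : cumOverlap ε u = ε := by
  have h1 : cumOverlap ε u = cumOverlap ε (2 * ε) := by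
    rw [← sub_eq_zero, ← integral_overlap, intervalIntegral.integral_congr
      (g := fun _ => (0 : ℝ)), intervalIntegral.integral_zero]
    intro t ht
    rw [uIcc_of_le hu] at ht
    exact overlap_of_le hε (ht.1.trans (le_abs_self t))
  rw [h1, cumOverlap, intervalIntegral.integral_congr (g := fun t => 1 - t / (2 * ε))]
  · rw [intervalIntegral.integral_sub (by simp) (Continuous.intervalIntegrable (by fun_prop) _ _),
      intervalIntegral.integral_div, integral_id]
    simp
    field_simp
    ring
  · intro t ht
    rw [uIcc_of_le (by positivity)] at ht
    simp only
    rw [overlap_of_abs_le hε (by rw [abs_of_nonneg ht.1]; exact ht.2), abs_of_nonneg ht.1]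

/-- Concavity: the primitive of a decreasing function that vanishes at `0` lies above its chord. -/
theorem mul_cumOverlap_one_le (hε : 0 < ε) {u : ℝ} (hu : u ∈ Icc (0 : ℝ) 1) :
    u * cumOverlap ε 1 ≤ cumOverlap ε u := by
  have h : cumOverlap ε u = u * ∫ s in (0 : ℝ)..1, overlap ε (u * s) := by
    have := intervalIntegral.mul_integral_comp_mul_left (f := overlap ε) (a := 0) (b := 1) u
    simp only [mul_zero, mul_one] at this
    rw [this, cumOverlap]
  rw [h, cumOverlap]
  refine mul_le_mul_of_nonneg_left (intervalIntegral.integral_mono_on zero_le_one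
    (continuous_overlap.intervalIntegrable _ _)
    ((continuous_overlap.comp (by fun_prop)).intervalIntegrable _ _) fun s hs => ?_) hu.1
  apply overlap_le_overlap hε
  rw [abs_mul, abs_of_nonneg hu.1]
  exact mul_le_of_le_one_left (abs_nonneg _) hu.2

theorem cumOverlap_one_pos (hε : 0 < ε) : 0 < cumOverlap ε 1 := by
  simpa using cumOverlap_lt hε le_rfl zero_lt_one (by positivity)

theorem two_le_ceil_mul (hε : 0 < ε) :
    2 ≤ ((⌈2 / cumOverlap ε 1⌉₊ : ℝ) + 1) * cumOverlap ε 1 := by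
  have h := cumOverlap_one_pos hε
  have := Nat.le_ceil (2 / cumOverlap ε 1)
  rw [← div_le_iff₀ h]
  linarith

end overlap

/-! ### The integral equations of the two weights. -/

/-- The total overlap of a message at `x` with uniformly distributed states. -/
def totalOverlap (ε x : ℝ) : ℝ := cumOverlap ε (1 - x) + cumOverlap ε (1 + x)

/-- The equation for the weight of the min rule. -/
def minData (ε : ℝ) (hε : 0 < ε) : EquationData where
  k x y := overlap ε (x - y) + overlap ε (x + y)
  p t y := overlapRate ε (t - y) + overlapRate ε (t + y)
  σ t := (overlap ε (1 - t) - overlap ε (1 + t)) / 2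
  b x := totalOverlap ε x - cumOverlap ε (2 * x)
  β x := overlap ε (1 - x) - overlap ε (1 + x) + 2 * overlap ε (2 * x)
  -- Here `k t t ≤ 2` and `b t ≥ cumOverlap ε (1 - t) ≥ (1 - t) * cumOverlap ε 1`, so `(n + 1) *
  -- cumOverlap ε 1 ≥ 2` suffices for `diag_le`.
  n := ⌈2 / cumOverlap ε 1⌉₊
  bound := (2 * ε)⁻¹ + (2 * ε)⁻¹
  continuous_k := by
    have := continuous_overlap (ε := ε)
    simp only [Function.uncurry_def]
    fun_prop
  measurable_p := by
    have := measurable_overlapRate (ε := ε)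
    simp only [Function.uncurry_def]
    fun_prop
  p_nonneg t y := add_nonneg (overlapRate_nonneg hε _) (overlapRate_nonneg hε _)
  p_le t y := add_le_add (overlapRate_le hε _) (overlapRate_le hε _)
  integral_p x y hy hyx hx := by
    rw [intervalIntegral.integral_add (intervalIntegrable_overlapRate_comp hε (by fun_prop) _ _)
      (intervalIntegrable_overlapRate_comp hε (by fun_prop) _ _),
      intervalIntegral.integral_comp_sub_right (fun t => overlapRate ε t),
      intervalIntegral.integral_comp_add_right (fun t => overlapRate ε t),
      integral_overlapRate hε (by linarith) (by linarith),
      integral_overlapRate hε (by linarith) (by linarith)]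
    ring
  continuous_σ := by
    have := continuous_overlap (ε := ε)
    fun_prop
  σ_nonneg t ht := by
    have : overlap ε (1 + t) ≤ overlap ε (1 - t) := by
      apply overlap_le_overlap hε
      rw [abs_of_nonneg (by linarith [ht.2]), abs_of_nonneg (by linarith [ht.1])]
      linarith [ht.1]
    linarith
  hasDerivAt_b x := by
    have h1 := (hasDerivAt_cumOverlap (ε := ε) (1 - x)).comp x ((hasDerivAt_id x).const_sub 1)
    have h2 := (hasDerivAt_cumOverlap (ε := ε) (1 + x)).comp x ((hasDerivAt_id x).const_add 1)
    have h3 := (hasDerivAt_cumOverlap (ε := ε) (2 * x)).comp x ((hasDerivAt_id x).const_mul 2)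
    refine ((h1.add h2).sub h3).congr_deriv ?_
    ring
  continuous_β := by
    have := continuous_overlap (ε := ε)
    fun_prop
  b_one := by norm_num [totalOverlap]
  b_pos x hx := by
    have h1 : cumOverlap ε 0 < cumOverlap ε (1 - x) :=
      cumOverlap_lt hε le_rfl (by linarith [hx.2]) (by positivity)
    have h2 : cumOverlap ε (2 * x) ≤ cumOverlap ε (1 + x) :=
      monotone_cumOverlap (by linarith [hx.2])
    rw [cumOverlap_zero] at h1
    rw [totalOverlap]
    linarith
  diag_le t ht := by
    have h1 := mul_cumOverlap_one_le hε (u := 1 - t) ⟨by linarith [ht.2], by linarith [ht.1]⟩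
    have h2 : cumOverlap ε (2 * t) ≤ cumOverlap ε (1 + t) :=
      monotone_cumOverlap (by linarith [ht.2])
    have h3 := overlap_le_one hε (t - t)
    have h4 := overlap_le_one hε (t + t)
    have h5 : 0 ≤ 1 - t := by linarith [ht.2]
    calc (1 - t) * (overlap ε (t - t) + overlap ε (t + t)) ≤ (1 - t) * 2 := by gcongr; linarith
      _ ≤ (1 - t) * (((⌈2 / cumOverlap ε 1⌉₊ : ℝ) + 1) * cumOverlap ε 1) := by
        gcongr; exact two_le_ceil_mul hε
      _ = ((⌈2 / cumOverlap ε 1⌉₊ : ℝ) + 1) * ((1 - t) * cumOverlap ε 1) := by ring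
      _ ≤ _ := by
        gcongr
        rw [totalOverlap]
        linarith
  half_supersolution t ht := by
    rw [intervalIntegral.integral_add (intervalIntegrable_overlapRate_comp hε (by fun_prop) _ _)
      (intervalIntegrable_overlapRate_comp hε (by fun_prop) _ _),
      intervalIntegral.integral_comp_sub_left (fun t => overlapRate ε t),
      intervalIntegral.integral_comp_add_left (fun t => overlapRate ε t),
      integral_overlapRate hε (by linarith [ht.1]) (by linarith [ht.1]),
      integral_overlapRate hε (by linarith [ht.1]) (by linarith [ht.1]), ← two_mul t]
    -- The right side exceeds the left by `2 * overlap ε (2 * t)`.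
    have := overlap_nonneg (ε := ε) (2 * t)
    simp only [sub_self, overlap_zero, sub_zero, add_zero]
    linarith

/-- The equation for the weight of the max rule, as a function of the distance to the extreme. -/
def maxData (ε : ℝ) (hε : 0 < ε) : EquationData where
  k x y := overlap ε (x - y) + overlap ε (2 - x - y)
  -- The truncation gives nonnegativity for all arguments; for `t ≤ 1` it is inactive, as `t - y ≤ 2
  -- - y - t` and the rate is antitone.
  p t y := max 0 (overlapRate ε (t - y) - overlapRate ε (2 - y - t))
  σ t := (overlap ε t - overlap ε (2 - t)) / 2
  b x := cumOverlap ε (2 * (1 - x))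
  β x := 2 * overlap ε (2 * (1 - x))
  n := ⌈2 / cumOverlap ε 1⌉₊
  bound := (2 * ε)⁻¹
  continuous_k := by
    have := continuous_overlap (ε := ε)
    simp only [Function.uncurry_def]
    fun_prop
  measurable_p := by
    have := measurable_overlapRate (ε := ε)
    simp only [Function.uncurry_def]
    fun_prop
  p_nonneg t y := le_max_left _ _
  p_le t y := max_le (by positivity)
    (by linarith [overlapRate_le hε (t - y), overlapRate_nonneg hε (2 - y - t)])
  integral_p x y hy hyx hx := by
    rw [intervalIntegral.integral_congr
      (g := fun t => overlapRate ε (t - y) - overlapRate ε (2 - y - t)),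
      intervalIntegral.integral_sub (intervalIntegrable_overlapRate_comp hε (by fun_prop) _ _)
      (intervalIntegrable_overlapRate_comp hε (by fun_prop) _ _),
      intervalIntegral.integral_comp_sub_right (fun t => overlapRate ε t),
      intervalIntegral.integral_comp_sub_left (fun t => overlapRate ε t),
      integral_overlapRate hε (by linarith) (by linarith),
      integral_overlapRate hε (by linarith) (by linarith)]
    · ring_nf
    · intro t ht
      rw [uIcc_of_le hx] at ht
      exact max_eq_right (sub_nonneg.2 (antitone_overlapRate hε (by linarith [ht.2])))
  continuous_σ := by
    have := continuous_overlap (ε := ε)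
    fun_prop
  σ_nonneg t ht := by
    have : overlap ε (2 - t) ≤ overlap ε t := by
      apply overlap_le_overlap hε
      rw [abs_of_nonneg ht.1, abs_of_nonneg (by linarith [ht.2])]
      linarith [ht.2]
    linarith
  hasDerivAt_b x := by
    have h3 := (hasDerivAt_cumOverlap (ε := ε) (2 * (1 - x))).comp x
      (((hasDerivAt_id x).const_sub 1).const_mul 2)
    refine h3.congr_deriv ?_
    ring
  continuous_β := by
    have := continuous_overlap (ε := ε)
    fun_prop
  b_one := by norm_num
  b_pos x hx := by
    have h1 : cumOverlap ε 0 < cumOverlap ε (2 * (1 - x)) :=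
      cumOverlap_lt hε le_rfl (by linarith [hx.2]) (by positivity)
    rwa [cumOverlap_zero] at h1
  diag_le t ht := by
    have h1 := mul_cumOverlap_one_le hε (u := 1 - t) ⟨by linarith [ht.2], by linarith [ht.1]⟩
    have h2 : cumOverlap ε (1 - t) ≤ cumOverlap ε (2 * (1 - t)) :=
      monotone_cumOverlap (by linarith [ht.2])
    have h3 := overlap_le_one hε (t - t)
    have h4 := overlap_le_one hε (2 - t - t)
    have h5 : 0 ≤ 1 - t := by linarith [ht.2]
    calc (1 - t) * (overlap ε (t - t) + overlap ε (2 - t - t)) ≤ (1 - t) * 2 := by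
          gcongr; linarith
      _ ≤ (1 - t) * (((⌈2 / cumOverlap ε 1⌉₊ : ℝ) + 1) * cumOverlap ε 1) := by
        gcongr; exact two_le_ceil_mul hε
      _ = ((⌈2 / cumOverlap ε 1⌉₊ : ℝ) + 1) * ((1 - t) * cumOverlap ε 1) := by ring
      _ ≤ _ := by
        gcongr
        linarith
  half_supersolution t ht := by
    rw [intervalIntegral.integral_congr
      (g := fun y => overlapRate ε (t - y) - overlapRate ε (2 - t - y)),
      intervalIntegral.integral_sub (intervalIntegrable_overlapRate_comp hε (by fun_prop) _ _)
      (intervalIntegrable_overlapRate_comp hε (by fun_prop) _ _),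
      intervalIntegral.integral_comp_sub_left (fun t => overlapRate ε t),
      intervalIntegral.integral_comp_sub_left (fun t => overlapRate ε t),
      integral_overlapRate hε (by linarith [ht.1]) (by linarith [ht.1]),
      integral_overlapRate hε (by linarith [ht.2]) (by linarith [ht.1])]
    · have e : 2 * (1 - t) = 2 - t - t := by ring
      -- The right side exceeds the left by `2 * overlap ε (2 - t - t)`.
      have := overlap_nonneg (ε := ε) (2 - t - t)
      simp only [sub_self, overlap_zero, sub_zero, e]
      linarith
    · intro y hy
      rw [uIcc_of_le ht.1.le] at hy
      simp only
      rw [sub_right_comm 2 y t]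
      exact max_eq_right (sub_nonneg.2 (antitone_overlapRate hε (by linarith [ht.2])))

/-- The bias of the min rule towards the more extreme speaker, as a function of the smaller
magnitude. -/
def minWeight (ε : ℝ) (hε : 0 < ε) (x : ℝ) : ℝ := (minData ε hε).solution x

/-- The bias of the max rule towards the more extreme speaker, as a function of the larger
magnitude. -/
def maxWeight (ε : ℝ) (hε : 0 < ε) (x : ℝ) : ℝ := (maxData ε hε).solution (1 - x)

/-! ### Equations and positivity of the weights. -/

section weights

variable {ε : ℝ} (hε : 0 < ε)

theorem measurable_minWeight : Measurable (minWeight ε hε) := (minData ε hε).measurable_solution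

theorem measurable_maxWeight : Measurable (maxWeight ε hε) :=
  (maxData ε hε).measurable_solution.comp (by fun_prop)

theorem minWeight_nonneg (x : ℝ) : 0 ≤ minWeight ε hε x := (minData ε hε).solution_nonneg x

theorem maxWeight_nonneg (x : ℝ) : 0 ≤ maxWeight ε hε x := (maxData ε hε).solution_nonneg _

theorem minWeight_le (x : ℝ) : minWeight ε hε x ≤ 1 / 2 := (minData ε hε).solution_le x

theorem maxWeight_le (x : ℝ) : maxWeight ε hε x ≤ 1 / 2 := (maxData ε hε).solution_le _

theorem minWeight_spec {x : ℝ} (hx : x ∈ Icc (0 : ℝ) 1) :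
    (∫ y in 0..x, (overlap ε (x - y) + overlap ε (x + y)) * minWeight ε hε y) -
        (totalOverlap ε x - cumOverlap ε (2 * x)) * minWeight ε hε x =
      (∫ y in 0..1, (overlap ε (1 - y) + overlap ε (1 + y)) * minWeight ε hε y) +
        cumOverlap ε 2 / 2 - totalOverlap ε x / 2 := by
  have h := (minData ε hε).solution_spec hx
  have hσ : ∫ t in x..1, (minData ε hε).σ t =
      totalOverlap ε x / 2 - cumOverlap ε 2 / 2 := by
    have hc := continuous_overlap (ε := ε)
    simp only [minData]
    rw [intervalIntegral.integral_div, intervalIntegral.integral_sub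
      (Continuous.intervalIntegrable (by fun_prop) _ _)
      (Continuous.intervalIntegrable (by fun_prop) _ _),
      intervalIntegral.integral_comp_sub_left (fun t => overlap ε t),
      intervalIntegral.integral_comp_add_left (fun t => overlap ε t), integral_overlap,
      integral_overlap, totalOverlap]
    norm_num
    ring
  rw [hσ] at h
  simp only [minData] at h
  simp only [minWeight, minData]
  linarith

theorem maxWeight_spec {x : ℝ} (hx : x ∈ Icc (0 : ℝ) 1) :
    cumOverlap ε (2 * x) * maxWeight ε hε x -
        ∫ y in x..1, (overlap ε (x - y) + overlap ε (x + y)) * maxWeight ε hε y =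
      (cumOverlap ε 1 - 2 * ∫ y in 0..1, overlap ε y * maxWeight ε hε y) -
        totalOverlap ε x / 2 := by
  have h := (maxData ε hε).solution_spec (x := 1 - x) ⟨by linarith [hx.2], by linarith [hx.1]⟩
  have hσ : ∫ t in (1 - x)..1, (maxData ε hε).σ t =
      cumOverlap ε 1 - totalOverlap ε x / 2 := by
    have hc := continuous_overlap (ε := ε)
    simp only [maxData]
    rw [intervalIntegral.integral_div, intervalIntegral.integral_sub
      (Continuous.intervalIntegrable (by fun_prop) _ _)
      (Continuous.intervalIntegrable (by fun_prop) _ _),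
      intervalIntegral.integral_comp_sub_left (fun t => overlap ε t), integral_overlap,
      integral_overlap, totalOverlap]
    ring_nf
  have e1 : ∫ y in x..1, (overlap ε (x - y) + overlap ε (x + y)) * maxWeight ε hε y =
      ∫ y in 0..(1 - x), (maxData ε hε).k (1 - x) y * (maxData ε hε).solution y := by
    have := intervalIntegral.integral_comp_sub_left (a := x) (b := 1)
      (fun y => (maxData ε hε).k (1 - x) y * (maxData ε hε).solution y) 1
    rw [sub_self] at this
    rw [← this]
    refine intervalIntegral.integral_congr fun y _ => ?_
    simp only [maxData, maxWeight]
    rw [overlap_sub_comm x y]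
    ring_nf
  have e2 : 2 * ∫ y in 0..1, overlap ε y * maxWeight ε hε y =
      ∫ y in 0..1, (maxData ε hε).k 1 y * (maxData ε hε).solution y := by
    have := intervalIntegral.integral_comp_sub_left (a := 0) (b := 1)
      (fun y => (maxData ε hε).k 1 y * (maxData ε hε).solution y) 1
    rw [sub_self, sub_zero] at this
    rw [← this, ← intervalIntegral.integral_const_mul]
    refine intervalIntegral.integral_congr fun y _ => ?_
    simp only [maxData, maxWeight]
    ring_nf
  have e3 : (maxData ε hε).b (1 - x) = cumOverlap ε (2 * x) := by
    simp [maxData]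
  rw [e1, e2, ← e3, maxWeight, h, hσ]
  ring

theorem minWeight_pos {x : ℝ} (hx : x ∈ Ico (0 : ℝ) 1) : 0 < minWeight ε hε x := by
  refine (minWeight_nonneg hε x).lt_of_ne' fun h0 => ?_
  have h := ((minData ε hε).vanishing_of_solution_eq_zero hx h0).1
  -- Within `2ε` of `1` the source `σ` is strictly positive.
  obtain ⟨t, ht, hP⟩ := exists_mem_Ioo_of_ae h (max_lt hx.2 (by linarith : 1 - 2 * ε < 1))
  have htx := max_lt_iff.1 ht.1
  have h1 := (hP ⟨htx.1, ht.2⟩).1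
  have h2 : overlap ε (1 + t) < overlap ε (1 - t) := by
    have e1 : |1 - t| = 1 - t := abs_of_pos (by linarith [ht.2])
    have e2 : |1 + t| = 1 + t := abs_of_pos (by linarith [hx.1])
    apply overlap_lt_overlap hε
    · rw [e1, e2]; linarith [hx.1]
    · rw [e1]; linarith
  simp only [minData] at h1
  linarith

/-- The source is positive only on `t < 2ε`, so it excludes zeros only there. Beyond that, a zero
forces zeros up to `2ε` to its left through the kernel `p`, so the zero set could be extended below
its infimum. -/
theorem maxData_solution_pos {x : ℝ} (hx : x ∈ Ico (0 : ℝ) 1) :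
    0 < (maxData ε hε).solution x := by
  set D := maxData ε hε with hD
  refine (D.solution_nonneg x).lt_of_ne' fun h0 => ?_
  let Z : Set ℝ := {z ∈ Ico (0 : ℝ) 1 | D.solution z = 0}
  have hZne : Z.Nonempty := ⟨x, hx, h0⟩
  have hZbdd : BddBelow Z := ⟨0, fun z hz => hz.1.1⟩
  have hZ2 (z : ℝ) (hz : z ∈ Z) : 2 * ε ≤ z := by
    by_contra! hlt
    have h := (D.vanishing_of_solution_eq_zero hz.1 hz.2).1
    obtain ⟨t, ht, hP⟩ := exists_mem_Ioo_of_ae h (lt_min hz.1.2 hlt)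
    have ht2 := lt_min_iff.1 ht.2
    have h1 := (hP ⟨ht.1, ht2.1⟩).1
    have h2 : overlap ε (2 - t) < overlap ε t := by
      have e1 : |t| = t := abs_of_pos (hz.1.1.trans_lt ht.1)
      have e2 : |2 - t| = 2 - t := abs_of_pos (by linarith)
      apply overlap_lt_overlap hε
      · rw [e1, e2]; linarith
      · rw [e1]; exact ht2.2
    simp only [hD, maxData] at h1
    linarith
  obtain ⟨z, hz, hzlt⟩ := exists_lt_of_csInf_lt hZne (lt_add_of_pos_right (sInf Z)
    (by positivity : 0 < 2 * ε))
  have h := (D.vanishing_of_solution_eq_zero hz.1 hz.2).1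
  obtain ⟨t, ht, hP⟩ := exists_mem_Ioo_of_ae h (lt_min hz.1.2 hzlt)
  have ht2 := lt_min_iff.1 ht.2
  have h1 := (hP ⟨ht.1, ht2.1⟩).2
  -- For `y` in this range, `t - y < 2ε ≤ 2 - y - t`, so only the first rate in `p t y` is nonzero.
  have hlow : t - 2 * ε < min (sInf Z) (2 - t - 2 * ε) := lt_min (by linarith) (by linarith)
  obtain ⟨y, hy, hPy⟩ := exists_mem_Ioo_of_ae h1 hlow
  have hy2 := lt_min_iff.1 hy.2
  have hy0 : 0 < y := by linarith [hy.1, ht.1, hZ2 z hz]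
  have hyz : y < z := hy2.1.trans_le (csInf_le hZbdd hz)
  have h3 := hPy ⟨hy0, hyz.trans ht.1⟩
  have hp : D.p t y = (2 * ε)⁻¹ := by
    simp only [hD, maxData, overlapRate]
    rw [if_pos (by linarith [hy.1]), if_neg (by linarith), sub_zero]
    exact max_eq_right (by positivity)
  have hy3 : D.solution y = 0 := by
    rw [hp] at h3
    exact (mul_eq_zero.1 h3).resolve_left (by positivity)
  exact absurd (csInf_le hZbdd (show y ∈ Z from ⟨⟨hy0.le, hyz.trans hz.1.2⟩, hy3⟩))
    (not_le.2 hy2.1)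

theorem maxWeight_pos {x : ℝ} (hx : x ∈ Ioc (0 : ℝ) 1) : 0 < maxWeight ε hε x :=
  maxData_solution_pos hε ⟨by linarith [hx.2], by linarith [hx.1]⟩

end weights

/-! ### The bias and the quack's indifference condition. -/

/-- The bias towards speaker 1: `v`, evaluated at the larger and the smaller magnitude, is the bias
towards the more extreme speaker. -/
def bias (v : ℝ → ℝ → ℝ) (m m' : ℝ) : ℝ :=
  if |m'| < |m| then v |m| |m'| else if |m| < |m'| then -v |m'| |m| else 0

theorem bias_antisymm (v : ℝ → ℝ → ℝ) (m m' : ℝ) : bias v m m' = -bias v m' m := by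
  unfold bias
  split_ifs <;> first | simp | (exfalso; linarith)

theorem measurable_bias {v : ℝ → ℝ → ℝ} (hv : Measurable (Function.uncurry v)) :
    Measurable (Function.uncurry (bias v)) := by
  have h1 : Measurable fun z : ℝ × ℝ => |z.1| := by fun_prop
  have h2 : Measurable fun z : ℝ × ℝ => |z.2| := by fun_prop
  refine Measurable.ite (measurableSet_lt h2 h1) (hv.comp (h1.prodMk h2))
    (Measurable.ite (measurableSet_lt h1 h2) (hv.comp (h2.prodMk h1)).neg measurable_const)

theorem abs_bias_le {v : ℝ → ℝ → ℝ} {c : ℝ} (hc : 0 ≤ c) (hv : ∀ x y, |v x y| ≤ c) (m m' : ℝ) :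
    |bias v m m'| ≤ c := by
  unfold bias
  split_ifs
  · exact hv _ _
  · rw [abs_neg]; exact hv _ _
  · simpa using hc

theorem intervalIntegrable_overlap_mul {ε : ℝ} {f g : ℝ → ℝ} (hf : Continuous f) (hg : Measurable g)
    {c : ℝ} (hgc : ∀ x, |g x| ≤ c) (a b : ℝ) :
    IntervalIntegrable (fun y => overlap ε (f y) * g y) volume a b := by
  rw [intervalIntegrable_iff]
  refine Integrable.mul_bdd (c := c) ?_ hg.aestronglyMeasurable (ae_of_all _ hgc)
  rw [← IntegrableOn, ← intervalIntegrable_iff]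
  exact (continuous_overlap.comp hf).intervalIntegrable _ _

/-- The bias depends on magnitudes only, so the integral folds onto `[0, 1]` with the symmetrized
kernel. Splitting at `|m|` separates the opponents whom `m` beats in magnitude from those who beat
it. -/
theorem integral_overlap_mul_bias {ε c : ℝ} {v : ℝ → ℝ → ℝ} (hv : Measurable (Function.uncurry v))
    (hc : 0 ≤ c) (hvc : ∀ x y, |v x y| ≤ c) {m : ℝ} (hm : |m| ≤ 1) :
    ∫ y in (-1)..1, overlap ε (m - y) * bias v m y =
      (∫ y in 0..|m|, (overlap ε (|m| - y) + overlap ε (|m| + y)) * v |m| y) -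
        ∫ y in |m|..1, (overlap ε (|m| - y) + overlap ε (|m| + y)) * v y |m| := by
  have hb : Measurable (bias v m) :=
    (measurable_bias hv).comp (by fun_prop : Measurable fun y : ℝ => (m, y))
  have hint (f : ℝ → ℝ) (hf : Continuous f) (a b : ℝ) :
      IntervalIntegrable (fun y => overlap ε (f y) * bias v m y) volume a b :=
    intervalIntegrable_overlap_mul hf hb (abs_bias_le hc hvc m) a b
  have h1 : ∫ y in (-1)..0, overlap ε (m - y) * bias v m y =
      ∫ y in 0..1, overlap ε (m + y) * bias v m y := by
    have := intervalIntegral.integral_comp_neg (a := 0) (b := 1)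
      (fun y => overlap ε (m - y) * bias v m y)
    rw [neg_zero] at this
    rw [← this]
    refine intervalIntegral.integral_congr fun y _ => ?_
    simp [bias]
  have h2 (y : ℝ) : overlap ε (m + y) + overlap ε (m - y) =
      overlap ε (|m| - y) + overlap ε (|m| + y) := by
    rcases abs_choice m with h | h
    · rw [h, add_comm]
    · rw [h, ← overlap_neg (m + y), ← overlap_neg (m - y)]
      ring_nf
  have hi : ∀ a b, IntervalIntegrable (fun y =>
      (overlap ε (|m| - y) + overlap ε (|m| + y)) * bias v m y) volume a b := by
    intro a b
    simp_rw [add_mul]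
    exact (hint _ (by fun_prop) a b).add (hint _ (by fun_prop) a b)
  rw [← intervalIntegral.integral_add_adjacent_intervals (hint _ (by fun_prop) _ 0)
    (hint _ (by fun_prop) _ _), h1, ← intervalIntegral.integral_add (hint _ (by fun_prop) _ _)
    (hint _ (by fun_prop) _ _)]
  simp_rw [← add_mul, h2]
  rw [← intervalIntegral.integral_add_adjacent_intervals (hi 0 |m|) (hi |m| 1), sub_eq_add_neg,
    ← intervalIntegral.integral_neg]
  congr 1
  · rw [intervalIntegral.integral_of_le (abs_nonneg m), intervalIntegral.integral_of_le
      (abs_nonneg m), integral_Ioc_eq_integral_Ioo, integral_Ioc_eq_integral_Ioo]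
    refine setIntegral_congr_fun measurableSet_Ioo fun y hy => ?_
    have : |y| = y := abs_of_pos hy.1
    simp only [bias, this, hy.2, if_true]
  · rw [intervalIntegral.integral_of_le hm, intervalIntegral.integral_of_le hm]
    refine setIntegral_congr_fun measurableSet_Ioc fun y hy => ?_
    have : |y| = y := abs_of_pos ((abs_nonneg m).trans_lt hy.1)
    simp only [bias, this, hy.1, hy.1.not_gt, if_true, if_false]
    ring

section weights

variable {ε : ℝ} (hε : 0 < ε)

theorem integral_overlap_mul_maxWeight_pos : 0 < ∫ y in 0..1, overlap ε y * maxWeight ε hε y := by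
  have h0 (y : ℝ) : 0 ≤ overlap ε y * maxWeight ε hε y :=
    mul_nonneg (overlap_nonneg y) (maxWeight_nonneg hε y)
  refine (intervalIntegral.integral_nonneg_of_forall zero_le_one h0).lt_of_ne' fun h => ?_
  have hi := intervalIntegrable_overlap_mul (ε := ε) continuous_id (measurable_maxWeight hε)
    (c := 1 / 2) (fun x => by rw [abs_of_nonneg (maxWeight_nonneg hε x)]; exact maxWeight_le hε x)
    0 1
  have hae := (intervalIntegral.integral_eq_zero_iff_of_le_of_nonneg_ae zero_le_one
    (ae_of_all _ h0) hi).1 h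
  obtain ⟨y, hy, hP⟩ := exists_mem_Ioo_of_ae ((ae_restrict_iff' measurableSet_Ioc).1 hae)
    (lt_min zero_lt_one (by positivity : 0 < 2 * ε))
  have hy2 := lt_min_iff.1 hy.2
  have h1 := maxWeight_pos hε ⟨hy.1, hy2.1.le⟩
  have h2 : overlap ε (2 * ε) < overlap ε y := by
    apply overlap_lt_overlap hε
    · rw [abs_of_pos hy.1, abs_of_pos (by positivity)]; exact hy2.2
    · rw [abs_of_pos hy.1]; exact hy2.2
  have h3 : overlap ε y * maxWeight ε hε y = 0 := hP ⟨hy.1, hy2.1.le⟩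
  exact (mul_pos ((overlap_nonneg _).trans_lt h2) h1).ne' h3

/-- Near the extreme messages the weight of the max rule is not almost everywhere constant. -/
theorem not_ae_maxWeight_eq_const (hε₁ : ε < 1) {c d₀ : ℝ} (hcε : ε ≤ c)
    (hc1 : c < 1) (h : ∀ᵐ y, y ∈ Ioo c 1 → maxWeight ε hε y = d₀) : False := by
  have hk := continuous_overlap (ε := ε)
  -- For `x ≥ ε` the overlap windows in `2 * x` and `1 + x` are exhausted and their primitives equal
  -- `ε`. With a constant weight the equation becomes affine in `cumOverlap ε (1 - x)`.
  have key (x : ℝ) (hx : x ∈ Ioo c 1) (hxd : maxWeight ε hε x = d₀) :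
      ε * d₀ - d₀ * cumOverlap ε (1 - x) =
        (cumOverlap ε 1 - 2 * ∫ y in 0..1, overlap ε y * maxWeight ε hε y) -
          (cumOverlap ε (1 - x) + ε) / 2 := by
    have hs := maxWeight_spec hε (x := x) ⟨by linarith [hx.1], hx.2.le⟩
    have hi : ∫ y in x..1, (overlap ε (x - y) + overlap ε (x + y)) * maxWeight ε hε y =
        d₀ * cumOverlap ε (1 - x) := by
      have e1 : ∫ y in x..1, (overlap ε (x - y) + overlap ε (x + y)) * maxWeight ε hε y =
          ∫ y in x..1, (overlap ε (y - x) + overlap ε (x + y)) * d₀ := by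
        rw [intervalIntegral.integral_of_le hx.2.le, intervalIntegral.integral_of_le hx.2.le,
          integral_Ioc_eq_integral_Ioo, integral_Ioc_eq_integral_Ioo]
        refine setIntegral_congr_ae measurableSet_Ioo ?_
        filter_upwards [h] with y hy hyx
        rw [hy ⟨hx.1.trans hyx.1, hyx.2⟩, overlap_sub_comm]
      rw [e1, intervalIntegral.integral_mul_const, intervalIntegral.integral_add
        (Continuous.intervalIntegrable (by fun_prop) _ _)
        (Continuous.intervalIntegrable (by fun_prop) _ _),
        intervalIntegral.integral_comp_sub_right (fun t => overlap ε t),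
        intervalIntegral.integral_comp_add_left (fun t => overlap ε t), integral_overlap,
        integral_overlap, sub_self, cumOverlap_zero,
        cumOverlap_of_le hε (u := x + 1) (by linarith [hx.1]),
        cumOverlap_of_le hε (u := x + x) (by linarith [hx.1])]
      ring
    rw [hi, totalOverlap, cumOverlap_of_le hε (u := 2 * x) (by linarith [hx.1]),
      cumOverlap_of_le hε (u := 1 + x) (by linarith [hx.1]), hxd] at hs
    linarith
  obtain ⟨x, hx, hxd⟩ := exists_mem_Ioo_of_ae h (max_lt hc1 (by linarith : 1 - 2 * ε < 1))
  have hx2 := max_lt_iff.1 hx.1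
  obtain ⟨z, hz, hzd⟩ := exists_mem_Ioo_of_ae h hx.2
  have kx := key x ⟨hx2.1, hx.2⟩ (hxd ⟨hx2.1, hx.2⟩)
  have kz := key z ⟨hx2.1.trans hz.1, hz.2⟩ (hzd ⟨hx2.1.trans hz.1, hz.2⟩)
  have hlt : cumOverlap ε (1 - z) < cumOverlap ε (1 - x) :=
    cumOverlap_lt hε (by linarith [hz.2]) (by linarith [hz.1]) (by linarith [hz.1])
  -- Two points force the slopes to agree, so the weight is `1/2`. The constant of the equation
  -- would then be `ε`, but it is `cumOverlap ε 1 ≤ ε` minus a positive integral.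
  have hd : d₀ = 1 / 2 := by
    have : (1 / 2 - d₀) * (cumOverlap ε (1 - x) - cumOverlap ε (1 - z)) = 0 := by linarith
    rcases mul_eq_zero.1 this with h0 | h0 <;> linarith
  have hpos := integral_overlap_mul_maxWeight_pos hε
  have h1 : cumOverlap ε 1 ≤ ε :=
    (monotone_cumOverlap (by norm_num)).trans (cumOverlap_of_le hε (u := 2) (by linarith)).le
  rw [hd] at kx
  linarith

/-- The indifference condition for the min rule. -/
theorem exists_integral_bias_minWeight : ∃ C, ∀ m : ℝ, |m| ≤ 1 →
    ∫ y in (-1)..1, overlap ε (m - y) * bias (fun _ y => minWeight ε hε y) m y =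
      C - totalOverlap ε |m| / 2 := by
  refine ⟨(∫ y in 0..1, (overlap ε (1 - y) + overlap ε (1 + y)) * minWeight ε hε y) +
    cumOverlap ε 2 / 2, fun m hm => ?_⟩
  have hw := measurable_minWeight hε
  have hk := continuous_overlap (ε := ε)
  rw [← minWeight_spec hε ⟨abs_nonneg m, hm⟩, integral_overlap_mul_bias (c := 1 / 2)
    (by simp only [Function.uncurry_def]; fun_prop) (by norm_num)
    (fun x y => by rw [abs_of_nonneg (minWeight_nonneg hε y)]; exact minWeight_le hε y) hm,
    intervalIntegral.integral_mul_const, intervalIntegral.integral_add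
        (Continuous.intervalIntegrable (by fun_prop) _ _)
        (Continuous.intervalIntegrable (by fun_prop) _ _)]
  simp_rw [overlap_sub_comm |m| _]
  rw [intervalIntegral.integral_comp_sub_right (fun t => overlap ε t),
    intervalIntegral.integral_comp_add_left (fun t => overlap ε t), integral_overlap,
    integral_overlap, sub_self, cumOverlap_zero, totalOverlap, two_mul, add_comm 1 |m|]
  ring

/-- The indifference condition for the max rule. -/
theorem exists_integral_bias_maxWeight : ∃ C, ∀ m : ℝ, |m| ≤ 1 →
    ∫ y in (-1)..1, overlap ε (m - y) * bias (fun x _ => maxWeight ε hε x) m y =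
      C - totalOverlap ε |m| / 2 := by
  refine ⟨cumOverlap ε 1 - 2 * ∫ y in 0..1, overlap ε y * maxWeight ε hε y, fun m hm => ?_⟩
  have hw := measurable_maxWeight hε
  have hk := continuous_overlap (ε := ε)
  rw [← maxWeight_spec hε ⟨abs_nonneg m, hm⟩, integral_overlap_mul_bias (c := 1 / 2)
    (by simp only [Function.uncurry_def]; fun_prop) (by norm_num)
    (fun x y => by rw [abs_of_nonneg (maxWeight_nonneg hε x)]; exact maxWeight_le hε x) hm,
    intervalIntegral.integral_mul_const, intervalIntegral.integral_add
        (Continuous.intervalIntegrable (by fun_prop) _ _)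
        (Continuous.intervalIntegrable (by fun_prop) _ _),
    intervalIntegral.integral_comp_sub_left (fun t => overlap ε t),
    intervalIntegral.integral_comp_add_left (fun t => overlap ε t), integral_overlap,
    integral_overlap, sub_self, cumOverlap_zero]
  ring_nf

end weights

/-! ### Consistency probabilities under uniform noise. -/

/-- The indicator of consistency. -/
def cons (ε m s : ℝ) : ℝ := if |m - s| ≤ ε then 1 else 0

theorem cons_eq_zero_or_one (ε m s : ℝ) : cons ε m s = 0 ∨ cons ε m s = 1 := by
  unfold cons
  split_ifs <;> simp

theorem cons_of_consistent {ε s : ℝ} {m : Message} (h : Consistent ε m s) : cons ε m s = 1 :=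
  if_pos h

theorem cons_of_not_consistent {ε s : ℝ} {m : Message} (h : ¬Consistent ε m s) :
    cons ε m s = 0 := if_neg h

theorem measurable_cons (ε : ℝ) : Measurable (Function.uncurry (cons ε)) :=
  Measurable.ite (measurableSet_le (by fun_prop) measurable_const) measurable_const
    measurable_const

@[fun_prop]
theorem measurable_cons_comp {α : Type*} [MeasurableSpace α] {ε : ℝ} {f g : α → ℝ}
    (hf : Measurable f) (hg : Measurable g) : Measurable fun x => cons ε (f x) (g x) :=
  (measurable_cons ε).comp (hf.prodMk hg)

/-- The probability that messages `a` and `b` are both consistent in state `ω`. -/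
def overlap₃ (ε a b ω : ℝ) : ℝ := max 0 (1 - (max (max a b) ω - min (min a b) ω) / (2 * ε))

theorem overlap₃_self_left (ε a ω : ℝ) : overlap₃ ε a a ω = overlap ε (a - ω) := by
  simp [overlap₃, overlap, max_sub_min_eq_abs']

theorem overlap₃_self_right (ε ω b : ℝ) : overlap₃ ε ω b ω = overlap ε (ω - b) := by
  rw [← overlap₃_self_left, overlap₃, overlap₃]
  congr 3
  grind

theorem overlap₃_nonneg (ε a b ω : ℝ) : 0 ≤ overlap₃ ε a b ω := le_max_left _ _

section noise

variable {ε : ℝ}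

theorem noise_eq (ε : ℝ) : noise ε = (ENNReal.ofReal (2 * ε))⁻¹ • volume.restrict (Icc (-ε) ε) := by
  rw [noise, ProbabilityTheory.cond, Real.volume_Icc]
  ring_nf

theorem integral_noise (hε : 0 < ε) (f : ℝ → ℝ) :
    ∫ e, f e ∂noise ε = (2 * ε)⁻¹ * ∫ e in Icc (-ε) ε, f e := by
  rw [noise_eq ε, integral_smul_measure, ENNReal.toReal_inv,
    ENNReal.toReal_ofReal (by positivity), smul_eq_mul]

/-- Both messages are consistent and the noise is admissible exactly when the signal lies within `ε`
of all of `a`, `b`, `ω`: an interval of length `2ε` minus their spread. -/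
theorem integral_cons_mul_cons (hε : 0 < ε) (a b ω : ℝ) :
    ∫ e, cons ε a (ω + e) * cons ε b (ω + e) ∂noise ε = overlap₃ ε a b ω := by
  have h (e : ℝ) : (Icc (-ε) ε).indicator (fun e => cons ε a (ω + e) * cons ε b (ω + e)) e =
      (Icc (max (max a b) ω - ω - ε) (min (min a b) ω - ω + ε)).indicator (fun _ => (1 : ℝ)) e := by
    have h1 : max (max a b) ω - ω - ε ≤ e ↔ (a ≤ e + ε + ω ∧ b ≤ e + ε + ω) ∧ ω ≤ e + ε + ω := by
      rw [sub_le_iff_le_add, sub_le_iff_le_add, max_le_iff, max_le_iff]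
    have h2 : e ≤ min (min a b) ω - ω + ε ↔ (e - ε + ω ≤ a ∧ e - ε + ω ≤ b) ∧ e - ε + ω ≤ ω := by
      rw [← sub_le_iff_le_add, le_sub_iff_add_le, le_min_iff, le_min_iff]
    simp only [indicator, cons, mem_Icc, abs_le, h1, h2]
    split_ifs <;> first | (norm_num; done) | (exfalso; grind)
  rw [integral_noise hε, ← integral_indicator measurableSet_Icc]
  simp_rw [h]
  rw [integral_indicator_const _ measurableSet_Icc, measureReal_def, Real.volume_Icc,
    ENNReal.toReal_ofReal', smul_eq_mul, mul_one, overlap₃, mul_comm, ← div_eq_mul_inv,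
    max_comm, ← max_div_div_right (by positivity), zero_div]
  congr 1
  field_simp
  ring

theorem integral_cons (hε : 0 < ε) (m ω : ℝ) :
    ∫ e, cons ε m (ω + e) ∂noise ε = overlap ε (m - ω) := by
  rw [← overlap₃_self_left, ← integral_cons_mul_cons hε]
  refine integral_congr_ae (ae_of_all _ fun e => ?_)
  rcases cons_eq_zero_or_one ε m (ω + e) with h | h <;> simp [h]

/-- With the signal as integration variable, its density given the state is proportional to the
consistency indicator. This makes the two conditional laws of the observation comparable. -/
theorem lintegral_noise_add (h : ℝ → ENNReal) (ω : ℝ) :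
    ∫⁻ e, h (ω + e) ∂noise ε =
      (ENNReal.ofReal (2 * ε))⁻¹ * ∫⁻ s, ENNReal.ofReal (cons ε ω s) * h s := by
  rw [noise_eq ε, lintegral_smul_measure, smul_eq_mul, ← lintegral_indicator measurableSet_Icc,
    ← lintegral_add_left_eq_self (fun s => ENNReal.ofReal (cons ε ω s) * h s) ω]
  congr 1
  refine lintegral_congr fun e => ?_
  simp only [indicator, cons, mem_Icc, sub_add_cancel_left, abs_neg, abs_le]
  split_ifs <;> simp

end noise

theorem integral_prior (f : ℝ → ℝ) : ∫ ω : Message, f ω ∂prior = (∫ x in (-1)..1, f x) / 2 := by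
  rw [prior, integral_subtype_comap measurableSet_Icc, ProbabilityTheory.cond,
    Measure.restrict_smul, Measure.restrict_restrict measurableSet_Icc, inter_self,
    integral_smul_measure, Real.volume_Icc, intervalIntegral.integral_of_le (by norm_num),
    integral_Icc_eq_integral_Ioc]
  norm_num
  ring

/-! ### Contest rules with a bias. -/

/-- The probability of selecting the first speaker under the rule with bias `η`. -/
def contestProb (ε : ℝ) (η : ℝ → ℝ → ℝ) (m m' s : ℝ) : ℝ :=
  1 / 2 + (cons ε m s - cons ε m' s) / 2 + cons ε m s * cons ε m' s * η m m'

/-- A measurable antisymmetric bias bounded by one half. -/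
structure IsBias (η : ℝ → ℝ → ℝ) : Prop where
  measurable : Measurable (Function.uncurry η)
  antisymm : ∀ m m', η m m' = -η m' m
  abs_le : ∀ m m', |η m m'| ≤ 1 / 2

theorem IsBias.measurable_comp {η : ℝ → ℝ → ℝ} (hη : IsBias η) {α : Type*} [MeasurableSpace α]
    {f g : α → ℝ} (hf : Measurable f) (hg : Measurable g) : Measurable fun x => η (f x) (g x) :=
  hη.measurable.comp (hf.prodMk hg)

theorem isBias_zero : IsBias fun _ _ => 0 := ⟨measurable_const, by simp, by simp⟩

theorem isBias_bias {v : ℝ → ℝ → ℝ} (hv : Measurable (Function.uncurry v))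
    (hvc : ∀ x y, |v x y| ≤ 1 / 2) : IsBias (bias v) :=
  ⟨measurable_bias hv, bias_antisymm v, abs_bias_le (by norm_num) hvc⟩

theorem measurable_contestProb {ε : ℝ} {η : ℝ → ℝ → ℝ} (hη : IsBias η) {α : Type*}
    [MeasurableSpace α] {f g h : α → ℝ} (hf : Measurable f) (hg : Measurable g)
    (hh : Measurable h) : Measurable fun x => contestProb ε η (f x) (g x) (h x) := by
  have := hη.measurable_comp hf hg
  have hc1 : Measurable fun x => cons ε (f x) (h x) := by fun_prop
  have hc2 : Measurable fun x => cons ε (g x) (h x) := by fun_prop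
  exact (measurable_const.add ((hc1.sub hc2).div_const 2)).add ((hc1.mul hc2).mul this)

theorem contestProb_nonneg {ε : ℝ} {η : ℝ → ℝ → ℝ} (hη : IsBias η) (m m' s : ℝ) :
    0 ≤ contestProb ε η m m' s := by
  have h := abs_le.1 (hη.abs_le m m')
  unfold contestProb
  rcases cons_eq_zero_or_one ε m s with h1 | h1 <;>
  rcases cons_eq_zero_or_one ε m' s with h2 | h2 <;> rw [h1, h2] <;> linarith

theorem contestProb_add {ε : ℝ} {η : ℝ → ℝ → ℝ} (hη : IsBias η) (m m' s : ℝ) :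
    contestProb ε η m m' s + contestProb ε η m' m s = 1 := by
  rw [contestProb, contestProb, hη.antisymm m m']
  ring

/-- The selection rule that selects the sender of the only consistent message, favors the first
speaker by `η` if both messages are consistent, and randomizes evenly if none is. -/
def contestRule (ε : ℝ) {η : ℝ → ℝ → ℝ} (hη : IsBias η) : SelectionRule where
  prob j x := if j = 0 then contestProb ε η x.1 x.2.1 x.2.2 else contestProb ε η x.2.1 x.1 x.2.2
  measurable_prob j := by
    split_ifs <;> exact measurable_contestProb hη (by fun_prop) (by fun_prop) (by fun_prop)
  prob_nonneg j x := by
    split_ifs <;> exact contestProb_nonneg hη _ _ _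
  sum_prob x := by
    simpa using contestProb_add hη _ _ _

section contestRule

variable {ε : ℝ} {η : ℝ → ℝ → ℝ} (hη : IsBias η)

theorem contestRule_zero (x : Obs) :
    (contestRule ε hη).prob 0 x = contestProb ε η x.1 x.2.1 x.2.2 := rfl

theorem contestRule_one (x : Obs) :
    (contestRule ε hη).prob 1 x = contestProb ε η x.2.1 x.1 x.2.2 := rfl

theorem symmetricRule_contestRule : SymmetricRule (contestRule ε hη) := fun _ _ _ => rfl

theorem selectsUniqueConsistent_contestRule : SelectsUniqueConsistent ε (contestRule ε hη) := by
  refine fun m₁ m₂ s => ⟨fun h1 h2 => ?_, fun h1 h2 => ?_⟩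
  · rw [contestRule_zero, contestProb, cons_of_consistent h1, cons_of_not_consistent h2]
    norm_num
  · rw [contestRule_one, contestProb, cons_of_consistent h2, cons_of_not_consistent h1]
    norm_num

theorem contestProb_of_consistent {m₁ m₂ : Message} {s : ℝ} (h1 : Consistent ε m₁ s)
    (h2 : Consistent ε m₂ s) : contestProb ε η m₁ m₂ s = 1 / 2 + η m₁ m₂ := by
  rw [contestProb, cons_of_consistent h1, cons_of_consistent h2]
  ring

/-- Without bias the rule is a belief system that justifies every bias. -/
theorem contestRule_judge_optimal (x : Obs) (j k : Fin 2) (h : 0 < (contestRule ε hη).prob j x) :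
    (contestRule ε isBias_zero).prob k x ≤ (contestRule ε isBias_zero).prob j x := by
  -- The unbiased belief is not even only if exactly one message is consistent, and then the bias
  -- term vanishes.
  have key (m m' s : ℝ) (h : 0 < contestProb ε η m m' s) :
      contestProb ε (fun _ _ => 0) m' m s ≤ contestProb ε (fun _ _ => 0) m m' s := by
    unfold contestProb at *
    rcases cons_eq_zero_or_one ε m s with h1 | h1 <;>
    rcases cons_eq_zero_or_one ε m' s with h2 | h2 <;> first | (norm_num [h1, h2] at h; done) |
      norm_num [h1, h2]
  fin_cases j <;> fin_cases k
  · rfl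
  · exact key _ _ _ h
  · exact key _ _ _ h
  · rfl

theorem integral_contestProb (hε : 0 < ε) (a b ω : ℝ) : ∫ e, contestProb ε η a b (ω + e) ∂noise ε =
    1 / 2 + (overlap ε (a - ω) - overlap ε (b - ω)) / 2 + overlap₃ ε a b ω * η a b := by
  have := isProbabilityMeasure_noise hε
  have hc (m : ℝ) : Integrable (fun e => cons ε m (ω + e)) (noise ε) := by
    refine Integrable.of_bound (by fun_prop : Measurable _).aestronglyMeasurable 1
      (ae_of_all _ fun e => ?_)
    rcases cons_eq_zero_or_one ε m (ω + e) with h | h <;> simp [h]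
  have hcc : Integrable (fun e => cons ε a (ω + e) * cons ε b (ω + e)) (noise ε) := by
    refine Integrable.of_bound (by fun_prop : Measurable _).aestronglyMeasurable 1
      (ae_of_all _ fun e => ?_)
    rcases cons_eq_zero_or_one ε a (ω + e) with h | h <;>
    rcases cons_eq_zero_or_one ε b (ω + e) with h' | h' <;> simp [h, h']
  have e1 := integral_add ((integrable_const (1 / 2 : ℝ)).add
    (((hc a).sub (hc b)).div_const 2)) (hcc.mul_const (η a b))
  have e2 := integral_add (integrable_const (1 / 2 : ℝ)) (((hc a).sub (hc b)).div_const 2)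
  have e3 := integral_sub (hc a) (hc b)
  have e4 : ∫ e, (cons ε a (ω + e) - cons ε b (ω + e)) / 2 ∂noise ε = _ := integral_div 2 _
  simp only [Pi.add_apply, Pi.sub_apply] at e1 e2 e3
  unfold contestProb
  rw [e1, e2, e4, e3, integral_mul_const, integral_cons_mul_cons hε, integral_cons hε,
    integral_cons hε]
  simp

end contestRule

theorem integral_obsLaw {ε : ℝ} (hε : 0 < ε) (ρ : Measure Message) [IsProbabilityMeasure ρ]
    (i : Fin 2) (κ : Kernel Message Message) [IsMarkovKernel κ] (q : Measure Message)
    [IsProbabilityMeasure q] {f : Obs → ℝ} (hf : Measurable f) {c : ℝ} (hc : ∀ x, |f x| ≤ c) :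
    ∫ x, f x ∂obsLaw ε ρ i κ q =
      ∫ ω, ∫ a, ∫ b, ∫ e, f (arrange i (((ω, a), b), e)) ∂noise ε ∂q ∂κ ω ∂ρ := by
  have := isProbabilityMeasure_noise hε
  have hg : Measurable fun x => f (arrange i x) := hf.comp (measurable_arrange i)
  have hi : Integrable (fun x => f (arrange i x)) (((ρ ⊗ₘ κ).prod q).prod (noise ε)) :=
    Integrable.of_bound hg.aestronglyMeasurable c (ae_of_all _ fun x => hc _)
  rw [obsLaw, integral_map (measurable_arrange i).aemeasurable hf.aestronglyMeasurable,
    integral_prod _ hi, integral_prod _ hi.integral_prod_left,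
    Measure.integral_compProd hi.integral_prod_left.integral_prod_left]

/-! ### Estimates behind the expert's truthfulness. -/

theorem cumOverlap_neg {ε : ℝ} (u : ℝ) : cumOverlap ε (-u) = -cumOverlap ε u := by
  have h := intervalIntegral.integral_comp_neg (a := 0) (b := u) (overlap ε)
  simp only [overlap_neg, neg_zero] at h
  rw [cumOverlap, intervalIntegral.integral_symm, ← h, cumOverlap]

theorem integral_overlap_sub {ε : ℝ} (ω : ℝ) :
    ∫ b in (-1)..1, overlap ε (b - ω) = totalOverlap ε |ω| := by
  have h : totalOverlap ε |ω| = totalOverlap ε ω := by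
    rcases abs_choice ω with h | h <;> rw [h]
    rw [totalOverlap, totalOverlap]
    ring_nf
  rw [h, intervalIntegral.integral_comp_sub_right (fun t => overlap ε t), integral_overlap,
    totalOverlap, ← neg_add', cumOverlap_neg, sub_neg_eq_add]

/-- Only the end nearer to `1` loses overlap, at a rate of at most `overlap ε (1 - v)` throughout
the interval. -/
theorem totalOverlap_sub_le {ε : ℝ} (hε : 0 < ε) {u v : ℝ} (huv : u ≤ v)
    (hv : v ≤ 1) : totalOverlap ε u - totalOverlap ε v ≤ (v - u) * overlap ε (1 - v) := by
  have h1 : cumOverlap ε (1 + u) ≤ cumOverlap ε (1 + v) := monotone_cumOverlap (by linarith)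
  have h2 : cumOverlap ε (1 - u) - cumOverlap ε (1 - v) ≤ (v - u) * overlap ε (1 - v) := by
    rw [← integral_overlap]
    have h3 : ∫ t in (1 - v)..(1 - u), overlap ε t ≤
        ∫ _ in (1 - v)..(1 - u), overlap ε (1 - v) := by
      refine intervalIntegral.integral_mono_on (by linarith)
        (continuous_overlap.intervalIntegrable _ _) (by simp) fun t ht => ?_
      apply overlap_le_overlap hε
      rw [abs_of_nonneg (by linarith), abs_of_nonneg (by linarith [ht.1])]
      exact ht.1
    refine h3.trans_eq ?_
    rw [intervalIntegral.integral_const, smul_eq_mul]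
    ring
  rw [totalOverlap, totalOverlap]
  linarith

/-- As the message moves outward, the loss at rate `overlap ε (1 - t)` outweighs the gain at rate
`overlap ε (1 + t)`. -/
theorem totalOverlap_antitone {ε : ℝ} (hε : 0 < ε) {u v : ℝ} (hu : 0 ≤ u) (huv : u ≤ v) :
    totalOverlap ε v ≤ totalOverlap ε u := by
  have h1 : cumOverlap ε (1 + v) - cumOverlap ε (1 + u) ≤
      cumOverlap ε (1 - u) - cumOverlap ε (1 - v) := by
    rw [← integral_overlap, ← integral_overlap,
      ← intervalIntegral.integral_comp_sub_left (fun t => overlap ε t),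
      ← intervalIntegral.integral_comp_add_left (fun t => overlap ε t)]
    have hc := continuous_overlap (ε := ε)
    refine intervalIntegral.integral_mono_on huv (Continuous.intervalIntegrable (by fun_prop) _ _)
      (Continuous.intervalIntegrable (by fun_prop) _ _) fun t ht => ?_
    apply overlap_le_overlap hε
    have ht0 := hu.trans ht.1
    rw [abs_of_nonneg (a := 1 + t) (by linarith)]
    exact abs_le.2 ⟨by linarith, by linarith⟩
  rw [totalOverlap, totalOverlap]
  linarith

theorem overlap₃_le_overlap {ε : ℝ} (hε : 0 < ε) (a b ω : ℝ) :
    overlap₃ ε a b ω ≤ overlap ε (a - b) := by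
  have h : |a - b| ≤ max (max a b) ω - min (min a b) ω := by
    rw [← max_sub_min_eq_abs']
    exact sub_le_sub (le_max_left _ _) (min_le_left _ _)
  unfold overlap₃ overlap
  gcongr

theorem overlap_sub_overlap₃_le {ε : ℝ} (hε : 0 < ε) (a b ω : ℝ) :
    overlap ε (a - b) - overlap₃ ε a b ω ≤ |a - ω| / (2 * ε) := by
  have h : max (max a b) ω - min (min a b) ω ≤ |a - b| + |a - ω| := by grind
  have h2 : (max (max a b) ω - min (min a b) ω) / (2 * ε) ≤
      |a - b| / (2 * ε) + |a - ω| / (2 * ε) := by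
    rw [← add_div]
    gcongr
  have h3 : 0 ≤ |a - ω| / (2 * ε) := by positivity
  rw [sub_le_iff_le_add]
  refine max_le (add_nonneg h3 (overlap₃_nonneg _ _ _ _)) ?_
  have h4 : 1 - (max (max a b) ω - min (min a b) ω) / (2 * ε) ≤ overlap₃ ε a b ω := le_max_right _ _
  linarith

theorem overlap₃_eq_overlap_of_mem {ε a b ω : ℝ} (h : ω ∈ uIcc a b) :
    overlap₃ ε a b ω = overlap ε (a - b) := by
  have h2 : max (max a b) ω - min (min a b) ω = |a - b| := by
    rw [uIcc, mem_Icc] at h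
    rw [max_eq_left h.2, min_eq_left h.1, max_sub_min_eq_abs']
  rw [overlap₃, overlap, h2]

theorem overlap₃_of_le {ε : ℝ} (hε : 0 < ε) {a b ω : ℝ} (h : 2 * ε ≤ |a - ω|) :
    overlap₃ ε a b ω = 0 := by
  have h2 : |a - ω| ≤ max (max a b) ω - min (min a b) ω := by grind
  have : 1 ≤ (max (max a b) ω - min (min a b) ω) / (2 * ε) :=
    (one_le_div (by positivity)).2 (h.trans h2)
  exact max_eq_left (by linarith)

/-- A bias that makes every message of the quack equally good and favors extreme messages. -/
structure IsIndifferentBias (ε : ℝ) (η : ℝ → ℝ → ℝ) (C : ℝ) : Prop extends IsBias η where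
  nonneg : ∀ m m', |m'| ≤ |m| → 0 ≤ η m m'
  indifferent : ∀ m, |m| ≤ 1 →
    ∫ y in (-1)..1, overlap ε (m - y) * η m y = C - totalOverlap ε |m| / 2

section

variable {ε C : ℝ} {η : ℝ → ℝ → ℝ}

theorem IsBias.intervalIntegrable_mul (hη : IsBias η) (m : ℝ) {f : ℝ → ℝ} {u v : ℝ}
    (hf : IntervalIntegrable f volume u v) :
    IntervalIntegrable (fun y => f y * η m y) volume u v := by
  rw [intervalIntegrable_iff] at hf ⊢
  exact Integrable.mul_bdd (c := 1 / 2) hf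
    (hη.measurable_comp measurable_const measurable_id).aestronglyMeasurable
    (ae_of_all _ fun y => hη.abs_le m y)

theorem intervalIntegrable_overlap₃ (a ω u v : ℝ) :
    IntervalIntegrable (fun b => overlap₃ ε a b ω) volume u v := by
  apply Continuous.intervalIntegrable
  unfold overlap₃
  fun_prop

/-- Against an indifferent bias no lie helps the expert: the gain in the contest does not make up
for the risk of being caught. -/
theorem IsIndifferentBias.integral_overlap₃_le (hη : IsIndifferentBias ε η C) (hε : 0 < ε)
    (hε₁ : ε < 1) {a ω : ℝ} (ha : |a| ≤ 1) (hω : |ω| ≤ 1) :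
    ∫ b in (-1)..1, overlap₃ ε a b ω * η a b ≤
      (1 - overlap ε (a - ω)) + (C - totalOverlap ε |ω| / 2) := by
  have hk := continuous_overlap (ε := ε)
  rcases le_total (2 * ε) |a - ω| with hfar | hnear
  -- A lie this far is never consistent. The truthful side is still nonnegative, as a bias of at
  -- least `-1/2` on an interval of length `2` costs at most `1`.
  · have h0 : ∫ b in (-1)..1, overlap₃ ε a b ω * η a b = 0 := by
      simp [overlap₃_of_le hε hfar]
    rw [h0, overlap_of_le hε hfar, ← hη.indifferent ω hω]
    have h1 : ∫ _ in (-1 : ℝ)..1, -(1 / 2 : ℝ) ≤ ∫ y in (-1)..1, overlap ε (ω - y) * η ω y := by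
      refine intervalIntegral.integral_mono_on (by norm_num) (by simp)
        (hη.intervalIntegrable_mul ω (Continuous.intervalIntegrable (by fun_prop) _ _))
        fun y _ => ?_
      have h2 := (abs_le.1 (hη.abs_le ω y)).1
      have h3 := overlap_le_one hε (ω - y)
      have h4 := overlap_nonneg (ε := ε) (ω - y)
      nlinarith
    rw [intervalIntegral.integral_const] at h1
    norm_num at h1
    linarith
  set r := |a - ω| / (2 * ε) with hr
  have hr0 : 0 ≤ r := by positivity
  have hδ : |a - ω| = r * (2 * ε) := by rw [hr]; field_simp
  rw [overlap_of_abs_le hε hnear, ← hr]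
  have hint := hη.intervalIntegrable_mul a (f := fun b => overlap ε (a - b)) (u := -1) (v := 1)
    (Continuous.intervalIntegrable (by fun_prop) _ _)
  have hint₃ := hη.intervalIntegrable_mul a (intervalIntegrable_overlap₃ (ε := ε) a ω (-1) 1)
  -- The indifference condition at the lie `a` isolates the effect of the state: contests lost
  -- because the signal is centred at `ω` instead of lying anywhere near `a` and `b`.
  have hsub : ∫ b in (-1)..1, overlap₃ ε a b ω * η a b =
      (C - totalOverlap ε |a| / 2) +
        ∫ b in (-1)..1, (overlap ε (a - b) - overlap₃ ε a b ω) * (-η a b) := by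
    rw [← hη.indifferent a ha, ← intervalIntegral.integral_add hint]
    · refine intervalIntegral.integral_congr fun b _ => ?_
      ring
    · have := (hint.sub hint₃).neg
      refine this.congr (fun b _ => ?_)
      simp only [Pi.neg_apply]
      ring
  have hint' : IntervalIntegrable (fun b => (overlap ε (a - b) - overlap₃ ε a b ω) * (-η a b))
      volume (-1) 1 := by
    refine (hint.sub hint₃).neg.congr (fun b _ => ?_)
    simp only [Pi.neg_apply]
    ring
  have hbound (b : ℝ) : (overlap ε (a - b) - overlap₃ ε a b ω) * (-η a b) ≤ r * (1 / 2) := by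
    have h1 := overlap_sub_overlap₃_le hε a b ω
    have h2 := overlap₃_le_overlap hε a b ω
    have h3 := (abs_le.1 (hη.abs_le a b)).1
    exact (mul_le_mul_of_nonneg_left (by linarith) (sub_nonneg.2 h2)).trans
      (mul_le_mul_of_nonneg_right h1 (by norm_num))
  rw [hsub]
  -- A lie towards the centre has the larger total overlap, so the crude bound `r / 2` on length `2`
  -- suffices. A lie outward loses total overlap and needs a finer bound.
  rcases le_or_gt |a| |ω| with hle | hlt
  · have h1 := totalOverlap_antitone hε (abs_nonneg a) hle
    have h2 : ∫ b in (-1)..1, (overlap ε (a - b) - overlap₃ ε a b ω) * (-η a b) ≤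
        ∫ _ in (-1 : ℝ)..1, r * (1 / 2) :=
      intervalIntegral.integral_mono_on (by norm_num) hint' (by simp) fun b _ => hbound b
    rw [intervalIntegral.integral_const, smul_eq_mul] at h2
    linarith
  · have h1 := totalOverlap_sub_le hε hlt.le ha
    have h3 : |a| - |ω| ≤ r * (2 * ε) := hδ ▸ abs_sub_abs_le_abs_sub a ω
    have h4 : (|a| - |ω|) * overlap ε (1 - |a|) ≤ r * (2 * ε) * overlap ε (1 - |a|) :=
      mul_le_mul_of_nonneg_right h3 (overlap_nonneg _)
    -- The integrand is positive at most where `|b| > |a|`, so that the bias may go against `a`, and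
    -- `ω` is not between `a` and `b`. Such `b` lie beyond `a` on the same side, a set of length `1
    -- - |a|`.
    have h2 : ∫ b in (-1)..1, (overlap ε (a - b) - overlap₃ ε a b ω) * (-η a b) ≤
        (1 - |a|) * (r * (1 / 2)) := by
      have hzero (b : ℝ) (hb : ¬ |a| < |b| ∨ ω ∈ uIcc a b) :
          (overlap ε (a - b) - overlap₃ ε a b ω) * (-η a b) ≤ 0 := by
        rcases hb with hb | hb
        · have := hη.nonneg a b (not_lt.1 hb)
          have := overlap₃_le_overlap hε a b ω
          exact mul_nonpos_of_nonneg_of_nonpos (by linarith) (by linarith)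
        · rw [overlap₃_eq_overlap_of_mem hb, sub_self, zero_mul]
      obtain ⟨ha1, ha2⟩ := abs_le.1 ha
      have hi1 := hint'.mono_set (c := -1) (d := a)
        (by rw [uIcc_of_le ha1, uIcc_of_le (by norm_num)]; exact Icc_subset_Icc_right ha2)
      have hi2 := hint'.mono_set (c := a) (d := 1)
        (by rw [uIcc_of_le ha2, uIcc_of_le (by norm_num)]; exact Icc_subset_Icc_left ha1)
      rw [← intervalIntegral.integral_add_adjacent_intervals hi1 hi2]
      rcases le_total 0 a with h0 | h0
      · rw [abs_of_nonneg h0] at hlt ⊢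
        have e1 := intervalIntegral.integral_mono_on ha1 hi1 (g := fun _ => 0) (by simp)
          fun b hb => hzero b ?_
        · have e2 := intervalIntegral.integral_mono_on ha2 hi2 (g := fun _ => r * (1 / 2)) (by simp)
            fun b _ => hbound b
          rw [intervalIntegral.integral_const, smul_eq_mul] at e1 e2
          linarith
        · by_cases hba : |a| < |b|
          · right
            rw [uIcc_of_ge hb.2, mem_Icc]
            rw [abs_of_nonneg h0] at hba
            have := abs_lt.1 hlt
            rcases abs_choice b with h | h <;> constructor <;> linarith [hb.2]
          · exact Or.inl hba
      · rw [abs_of_nonpos h0] at hlt ⊢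
        have e2 := intervalIntegral.integral_mono_on ha2 hi2 (g := fun _ => 0) (by simp)
          fun b hb => hzero b ?_
        · have e1 := intervalIntegral.integral_mono_on ha1 hi1 (g := fun _ => r * (1 / 2)) (by simp)
            fun b _ => hbound b
          rw [intervalIntegral.integral_const, smul_eq_mul] at e1 e2
          linarith
        · by_cases hba : |a| < |b|
          · right
            rw [uIcc_of_le hb.1, mem_Icc]
            rw [abs_of_nonpos h0] at hba
            have := abs_lt.1 hlt
            rcases abs_choice b with h | h <;> constructor <;> linarith [hb.1]
          · exact Or.inl hba
    -- For `u = 1 - |a| ≤ 2ε` the left side equals `2ε`, which is where `ε < 1` enters; otherwise it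
    -- is just `u ≤ 1`.
    have h5 : 2 * ε * overlap ε (1 - |a|) + (1 - |a|) ≤ 2 := by
      rcases le_total (2 * ε) (1 - |a|) with h | h
      · rw [overlap_of_le hε (h.trans (le_abs_self _))]
        linarith [abs_nonneg a]
      · have h0 : |(1 - |a|)| = 1 - |a| := abs_of_nonneg (by linarith)
        rw [overlap_of_abs_le hε (h0.trans_le h), h0, mul_sub, mul_div_cancel₀ _ (by positivity)]
        linarith
    have h6 := mul_le_mul_of_nonneg_left h5 hr0
    linarith

end

/-! ### Payoffs, posteriors and equilibrium. -/

section

variable {ε C : ℝ} {η : ℝ → ℝ → ℝ}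

theorem abs_coe_message_le (m : Message) : |(m : ℝ)| ≤ 1 := abs_le.2 m.2

theorem abs_contestRule_le (hη : IsBias η) (j : Fin 2) (x : Obs) :
    |(contestRule ε hη).prob j x| ≤ 1 := by
  rw [abs_of_nonneg ((contestRule ε hη).prob_nonneg j x)]
  exact (contestRule ε hη).prob_le_one j x

theorem selProb_contestRule_expert (hη : IsBias η) (hε : 0 < ε) (ρ : Measure Message)
    [IsProbabilityMeasure ρ] (i : Fin 2) (κ : Kernel Message Message) [IsMarkovKernel κ]
    (q : Measure Message) [IsProbabilityMeasure q] :
    selProb (contestRule ε hη) i (obsLaw ε ρ i κ q) =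
      ∫ ω, ∫ a, ∫ b, ∫ e, contestProb ε η a b (ω + e) ∂noise ε ∂q ∂κ ω ∂ρ := by
  rw [selProb, integral_obsLaw hε ρ i κ q ((contestRule ε hη).measurable_prob i)
    (abs_contestRule_le hη i)]
  fin_cases i <;> rfl

theorem selProb_contestRule_quack (hη : IsBias η) (hε : 0 < ε) (ρ : Measure Message)
    [IsProbabilityMeasure ρ] (i : Fin 2) (κ : Kernel Message Message) [IsMarkovKernel κ]
    (q : Measure Message) [IsProbabilityMeasure q] :
    selProb (contestRule ε hη) i (obsLaw ε ρ i.rev κ q) =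
      ∫ ω, ∫ a, ∫ b, ∫ e, contestProb ε η b a (ω + e) ∂noise ε ∂q ∂κ ω ∂ρ := by
  rw [selProb, integral_obsLaw hε ρ i.rev κ q ((contestRule ε hη).measurable_prob i)
    (abs_contestRule_le hη i)]
  fin_cases i <;> rfl

/-- The expert's payoff from message `a` in state `ω` against a uniform quack. -/
theorem integral_integral_contestProb (hη : IsBias η) (hε : 0 < ε) (a ω : ℝ) :
    ∫ b : Message, ∫ e, contestProb ε η a b (ω + e) ∂noise ε ∂prior =
      1 / 2 + overlap ε (a - ω) / 2 - totalOverlap ε |ω| / 4 +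
        (∫ b in (-1)..1, overlap₃ ε a b ω * η a b) / 2 := by
  have hk := continuous_overlap (ε := ε)
  simp_rw [integral_contestProb hε]
  rw [integral_prior (fun b => 1 / 2 + (overlap ε (a - ω) - overlap ε (b - ω)) / 2 +
    overlap₃ ε a b ω * η a b), intervalIntegral.integral_add
      (Continuous.intervalIntegrable (by fun_prop) _ _)
      (hη.intervalIntegrable_mul a (intervalIntegrable_overlap₃ a ω _ _)),
    intervalIntegral.integral_add (by simp) (Continuous.intervalIntegrable (by fun_prop) _ _),
    intervalIntegral.integral_div 2
      (fun b => overlap ε (a - ω) - overlap ε (b - ω)),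
    intervalIntegral.integral_sub (by simp)
      (Continuous.intervalIntegrable (by fun_prop) _ _), integral_overlap_sub]
  simp only [intervalIntegral.integral_const, smul_eq_mul]
  ring

theorem IsIndifferentBias.truthful_payoff (hη : IsIndifferentBias ε η C) (hε : 0 < ε)
    (ω : Message) :
    ∫ b : Message, ∫ e, contestProb ε η ω b (ω + e) ∂noise ε ∂prior =
      1 + C / 2 - totalOverlap ε |(ω : ℝ)| / 2 := by
  rw [integral_integral_contestProb hη.toIsBias hε]
  simp_rw [overlap₃_self_right]
  rw [hη.indifferent ω (abs_coe_message_le ω), sub_self, overlap_zero]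
  ring

theorem continuous_totalOverlap : Continuous fun x => totalOverlap ε |x| := by
  have := continuous_cumOverlap (ε := ε)
  unfold totalOverlap
  fun_prop

theorem integrable_prior_of_continuous {f : ℝ → ℝ} (hf : Continuous f) (ρ : Measure Message)
    [IsFiniteMeasure ρ] : Integrable (fun ω : Message => f ω) ρ :=
  (hf.comp continuous_subtype_val).integrable_of_hasCompactSupport
    (HasCompactSupport.of_compactSpace _)

/-- Truth-telling is optimal for the expert under any belief about the state. -/
theorem IsIndifferentBias.expert_optimal (hη : IsIndifferentBias ε η C) (hε : 0 < ε) (hε₁ : ε < 1)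
    (ρ : Measure Message) [IsProbabilityMeasure ρ] (i : Fin 2) (κ : Kernel Message Message)
    [IsMarkovKernel κ] :
    selProb (contestRule ε hη.toIsBias) i (obsLaw ε ρ i κ prior) ≤
      selProb (contestRule ε hη.toIsBias) i (obsLaw ε ρ i Kernel.id prior) := by
  have hnonneg (ω a : ℝ) : 0 ≤ ∫ b : Message, ∫ e, contestProb ε η a b (ω + e) ∂noise ε ∂prior :=
    integral_nonneg fun b => integral_nonneg fun e => contestProb_nonneg hη.toIsBias _ _ _
  rw [selProb_contestRule_expert hη.toIsBias hε, selProb_contestRule_expert hη.toIsBias hε]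
  have hid (ω : Message) : ∫ a : Message, ∫ b : Message, ∫ e, contestProb ε η a b (ω + e)
      ∂noise ε ∂prior ∂(Kernel.id : Kernel Message Message) ω =
        1 + C / 2 - totalOverlap ε |(ω : ℝ)| / 2 := by
    rw [Kernel.id_apply, integral_dirac, hη.truthful_payoff hε]
  simp_rw [hid]
  refine integral_mono_of_nonneg (ae_of_all _ fun ω => integral_nonneg fun a => hnonneg ω a)
    (integrable_prior_of_continuous (f := fun ω => 1 + C / 2 - totalOverlap ε |ω| / 2)
      (by have := continuous_totalOverlap (ε := ε); fun_prop) ρ) (ae_of_all _ fun ω => ?_)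
  have h := integral_mono_of_nonneg (μ := κ ω) (ae_of_all _ fun a : Message => hnonneg ω a)
    (integrable_const (1 + C / 2 - totalOverlap ε |(ω : ℝ)| / 2)) (ae_of_all _ fun a => ?_)
  · simpa using h
  · have h1 := hη.integral_overlap₃_le hε hε₁ (abs_coe_message_le a) (abs_coe_message_le ω)
    simp only
    rw [integral_integral_contestProb hη.toIsBias hε]
    linarith

/-- Every strategy of the quack is equally good against a truthful expert. -/
theorem IsIndifferentBias.quack_payoff (hη : IsIndifferentBias ε η C) (hε : 0 < ε) (i : Fin 2)
    (q : Measure Message) [IsProbabilityMeasure q] :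
    selProb (contestRule ε hη.toIsBias) i (obsLaw ε prior i.rev Kernel.id q) = C / 2 := by
  have hk := continuous_overlap (ε := ε)
  rw [selProb_contestRule_quack hη.toIsBias hε]
  have h1 (ω : Message) : ∫ a : Message, ∫ b : Message, ∫ e, contestProb ε η b a (ω + e)
      ∂noise ε ∂q ∂(Kernel.id : Kernel Message Message) ω =
        ∫ b : Message, (overlap ε (b - ω) / 2 + overlap ε (b - ω) * η b ω) ∂q := by
    rw [Kernel.id_apply, integral_dirac]
    refine integral_congr_ae (ae_of_all _ fun b => ?_)
    have : overlap₃ ε (b : ℝ) ω ω = overlap ε (b - ω) :=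
      overlap₃_eq_overlap_of_mem right_mem_uIcc
    simp only
    rw [integral_contestProb hε, this, sub_self, overlap_zero]
    ring
  simp_rw [h1]
  -- Integrating over the state first, at a fixed message of the quack, puts the integrand in the
  -- form of the indifference condition.
  rw [integral_integral_swap]
  · have h2 (b : Message) : ∫ ω : Message, (overlap ε (b - ω) / 2 + overlap ε (b - ω) * η b ω)
        ∂prior = C / 2 := by
      rw [integral_prior (fun ω => overlap ε (b - ω) / 2 + overlap ε (b - ω) * η b ω),
        intervalIntegral.integral_add (Continuous.intervalIntegrable (by fun_prop) _ _)
        (hη.intervalIntegrable_mul b (Continuous.intervalIntegrable (by fun_prop) _ _)),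
        hη.indifferent b (abs_coe_message_le b), intervalIntegral.integral_div]
      simp_rw [overlap_sub_comm (b : ℝ) _]
      rw [integral_overlap_sub]
      ring
    simp_rw [h2]
    simp
  · have hm : Measurable fun z : Message × Message => η z.2 z.1 :=
      hη.measurable_comp (by fun_prop) (by fun_prop)
    have hm' := hk.measurable
    have hm'' : Measurable fun z : Message × Message => overlap ε (z.2 - z.1) := by fun_prop
    refine Integrable.of_bound (C := 1) ((hm''.div_const 2).add (hm''.mul hm)).aestronglyMeasurable
      (ae_of_all _ fun z => ?_)
    simp only [Function.uncurry]
    have h3 := abs_le.1 (hη.abs_le z.2 z.1)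
    have h4 := overlap_nonneg (ε := ε) (z.2 - z.1)
    have h5 := overlap_le_one hε (z.2 - z.1)
    rw [Real.norm_eq_abs, abs_le]
    constructor <;> nlinarith

theorem lintegral_truthful_zero (hε : 0 < ε) {f : Obs → ENNReal} (hf : Measurable f) :
    ∫⁻ x, f x ∂lawIfExpert ε truthfulUniform 0 =
      ∫⁻ ω : Message, ∫⁻ b : Message, (ENNReal.ofReal (2 * ε))⁻¹ *
        (∫⁻ s : ℝ, ENNReal.ofReal (cons ε ω s) * f (ω, b, s)) ∂prior ∂prior := by
  simp only [lawIfExpert, truthfulUniform]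
  rw [lintegral_obsLaw hε _ _ _ _ hf]
  refine lintegral_congr fun ω => ?_
  rw [Kernel.id_apply, lintegral_dirac]
  exact lintegral_congr fun b => lintegral_noise_add (fun s => f (ω, b, s)) ω

theorem lintegral_truthful_one (hε : 0 < ε) {f : Obs → ENNReal} (hf : Measurable f) :
    ∫⁻ x, f x ∂lawIfExpert ε truthfulUniform 1 =
      ∫⁻ ω : Message, ∫⁻ b : Message, (ENNReal.ofReal (2 * ε))⁻¹ *
        (∫⁻ s : ℝ, ENNReal.ofReal (cons ε ω s) * f (b, ω, s)) ∂prior ∂prior := by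
  simp only [lawIfExpert, truthfulUniform]
  rw [lintegral_obsLaw hε _ _ _ _ hf]
  refine lintegral_congr fun ω => ?_
  rw [Kernel.id_apply, lintegral_dirac]
  exact lintegral_congr fun b => lintegral_noise_add (fun s => f (b, ω, s)) ω

/-- Without bias the rule gives the posterior probabilities of the expert's identity. -/
theorem lintegral_belief_swap (hε : 0 < ε) {g : Obs → ENNReal} (hg : Measurable g) :
    ∫⁻ x, g x * ENNReal.ofReal ((contestRule ε isBias_zero).prob 0 x)
        ∂lawIfExpert ε truthfulUniform 1 =
      ∫⁻ x, g x * ENNReal.ofReal ((contestRule ε isBias_zero).prob 1 x)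
        ∂lawIfExpert ε truthfulUniform 0 := by
  have hp (j : Fin 2) : Measurable fun x =>
      g x * ENNReal.ofReal ((contestRule ε isBias_zero).prob j x) :=
    hg.mul ((contestRule ε isBias_zero).measurable_prob j).ennreal_ofReal
  rw [lintegral_truthful_zero hε (hp 1), lintegral_truthful_one hε (hp 0),
    lintegral_lintegral_swap]
  · refine lintegral_congr fun a => lintegral_congr fun b => ?_
    congr 1
    refine lintegral_congr fun s => ?_
    -- Pointwise Bayes: the density of each law is the consistency indicator of its expert's
    -- message, and likelihood times the opposite belief agrees in all four cases.
    rw [contestRule_zero, contestRule_one, contestProb, contestProb]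
    rcases cons_eq_zero_or_one ε a s with h1 | h1 <;>
    rcases cons_eq_zero_or_one ε b s with h2 | h2 <;> norm_num [h1, h2]
  · have hm : Measurable fun z : (Message × Message) × ℝ =>
        ENNReal.ofReal (cons ε z.1.1 z.2) * (g (z.1.2, z.1.1, z.2) *
          ENNReal.ofReal ((contestRule ε isBias_zero).prob 0 (z.1.2, z.1.1, z.2))) := by
      refine Measurable.mul (by fun_prop) ?_
      exact (hp 0).comp
        (by fun_prop : Measurable fun z : (Message × Message) × ℝ => ((z.1.2, z.1.1, z.2) : Obs))
    exact (hm.lintegral_prod_right'.const_mul _).aemeasurable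

theorem bayesConsistent_contestRule_zero (hε : 0 < ε) :
    BayesConsistent ε truthfulUniform (contestRule ε isBias_zero) := by
  set β := contestRule ε isBias_zero with hβ
  have hL := isProbabilityMeasure_lawIfExpert hε truthfulUniform
  intro j A hA
  have hr (i : Fin 2) (L : Measure Obs) [IsFiniteMeasure L] :
      ENNReal.ofReal (∫ x in A, β.prob i x ∂L) =
        ∫⁻ x, A.indicator (fun _ => 1) x * ENNReal.ofReal (β.prob i x) ∂L := by
    rw [ofReal_integral_eq_lintegral_ofReal (β.integrable_prob i L).integrableOn
      (ae_of_all _ (β.prob_nonneg i)), ← lintegral_indicator hA]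
    refine lintegral_congr fun x => ?_
    by_cases hx : x ∈ A <;> simp [hx]
  have key : ∫ x in A, β.prob 0 x ∂lawIfExpert ε truthfulUniform 1 =
      ∫ x in A, β.prob 1 x ∂lawIfExpert ε truthfulUniform 0 := by
    have := lintegral_belief_swap hε (g := A.indicator fun _ => 1) (measurable_const.indicator hA)
    rw [← hr, ← hr] at this
    exact (ENNReal.ofReal_eq_ofReal_iff (integral_nonneg (β.prob_nonneg 0))
      (integral_nonneg (β.prob_nonneg 1))).1 this
  have hsum (L : Measure Obs) [IsFiniteMeasure L] :
      ∫ x in A, β.prob 0 x ∂L + ∫ x in A, β.prob 1 x ∂L = L.real A := by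
    rw [← integral_add (β.integrable_prob 0 L).integrableOn (β.integrable_prob 1 L).integrableOn]
    simp [β.sum_prob]
  have htot : ∫ x in A, β.prob j x ∂totalLaw ε truthfulUniform =
      (∫ x in A, β.prob j x ∂lawIfExpert ε truthfulUniform 0) / 2 +
      (∫ x in A, β.prob j x ∂lawIfExpert ε truthfulUniform 1) / 2 := by
    rw [totalLaw, Measure.restrict_add, Measure.restrict_smul, Measure.restrict_smul,
      integral_add_measure, integral_smul_measure, integral_smul_measure]
    · simp
      ring
    · exact (β.integrable_prob j _).integrableOn.smul_measure (by simp)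
    · exact (β.integrable_prob j _).integrableOn.smul_measure (by simp)
  have h0 := hsum (lawIfExpert ε truthfulUniform 0)
  have h1 := hsum (lawIfExpert ε truthfulUniform 1)
  rw [htot]
  fin_cases j
  · simp only [Fin.zero_eta]
    linarith
  · simp only [Fin.mk_one]
    linarith

/-- An indifferent bias supports truth-telling and a uniform quack as an equilibrium. -/
theorem IsIndifferentBias.isEquilibrium (hη : IsIndifferentBias ε η C) (hε : 0 < ε)
    (hε₁ : ε < 1) : IsEquilibrium ε truthfulUniform (contestRule ε hη.toIsBias) where
  expert_optimal i κ _ := hη.expert_optimal hε hε₁ prior i κ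
  quack_optimal i q _ := by
    simp only [truthfulUniform]
    rw [hη.quack_payoff hε, hη.quack_payoff hε]
  judge_optimal := ⟨_, bayesConsistent_contestRule_zero hε, contestRule_judge_optimal hη.toIsBias⟩

theorem IsIndifferentBias.supportsRewardingExtremes (hη : IsIndifferentBias ε η C) (hε : 0 < ε)
    (hε₁ : ε < 1) (hpos : ∀ m m' : Message, |(m' : ℝ)| < |(m : ℝ)| → 0 < η m m') :
    SupportsRewardingExtremes ε (contestRule ε hη.toIsBias) where
  best := isBestEquilibrium_truthfulUniform hε (hη.isEquilibrium hε hε₁)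
  every_state i ω κ _ := hη.expert_optimal hε hε₁ (Measure.dirac ω) i κ
  symmetric := symmetricRule_contestRule _
  unique_consistent := selectsUniqueConsistent_contestRule _
  favors_extreme m₁ m₂ s h1 h2 := by
    refine ⟨fun h => ?_, fun h => ?_⟩
    · rw [contestRule_zero, contestProb_of_consistent h1 h2]
      linarith [hpos _ _ h]
    · rw [contestRule_one, contestProb_of_consistent h2 h1]
      linarith [hpos _ _ h]

end

/-! ### The max rule, the min rule and their difference. -/

theorem ae_of_ae_prior {P : Message → Prop} (h : ∀ᵐ m ∂prior, P m) :
    ∀ᵐ x : ℝ, ∀ hx : x ∈ Icc (-1 : ℝ) 1, P ⟨x, hx⟩ := by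
  have h1 : ∀ᵐ m : Message ∂prior, ∀ hx : (m : ℝ) ∈ Icc (-1 : ℝ) 1, P ⟨m, hx⟩ := by
    filter_upwards [h] with m hm _
    exact hm
  rw [← (MeasurableEmbedding.subtype_coe measurableSet_Icc).ae_map_iff
    (p := fun x : ℝ => ∀ hx : x ∈ Icc (-1 : ℝ) 1, P ⟨x, hx⟩), prior,
    map_comap_subtype_coe measurableSet_Icc, ProbabilityTheory.cond, Measure.restrict_smul,
    Measure.restrict_restrict measurableSet_Icc, inter_self,
    Measure.ae_ennreal_smul_measure_iff (by simp), ae_restrict_iff' measurableSet_Icc] at h1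
  filter_upwards [h1] with x hx hxI
  exact hx hxI hxI

section

variable {ε : ℝ} (hε : 0 < ε)

theorem isBias_maxWeight : IsBias (bias fun x _ => maxWeight ε hε x) :=
  isBias_bias ((measurable_maxWeight hε).comp measurable_fst) fun x _ => by
    rw [abs_of_nonneg (maxWeight_nonneg hε x)]
    exact maxWeight_le hε x

theorem isBias_minWeight : IsBias (bias fun _ y => minWeight ε hε y) :=
  isBias_bias ((measurable_minWeight hε).comp measurable_snd) fun _ y => by
    rw [abs_of_nonneg (minWeight_nonneg hε y)]
    exact minWeight_le hε y

theorem bias_nonneg {v : ℝ → ℝ → ℝ} (hv : ∀ x y, 0 ≤ v x y) {m m' : ℝ} (h : |m'| ≤ |m|) :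
    0 ≤ bias v m m' := by
  unfold bias
  split_ifs with h1 h2
  · exact hv _ _
  · exact absurd h (not_le.2 h2)
  · rfl

theorem bias_of_lt {v : ℝ → ℝ → ℝ} {m m' : ℝ} (h : |m'| < |m|) : bias v m m' = v |m| |m'| :=
  if_pos h

theorem bias_of_gt {v : ℝ → ℝ → ℝ} {m m' : ℝ} (h : |m| < |m'|) : bias v m m' = -v |m'| |m| := by
  rw [bias_antisymm, bias_of_lt h]

theorem exists_isIndifferentBias_maxWeight :
    ∃ C, IsIndifferentBias ε (bias fun x _ => maxWeight ε hε x) C := by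
  obtain ⟨C, hC⟩ := exists_integral_bias_maxWeight hε
  exact ⟨C, isBias_maxWeight hε, fun _ _ h => bias_nonneg (fun x _ => maxWeight_nonneg hε x) h, hC⟩

theorem exists_isIndifferentBias_minWeight :
    ∃ C, IsIndifferentBias ε (bias fun _ y => minWeight ε hε y) C := by
  obtain ⟨C, hC⟩ := exists_integral_bias_minWeight hε
  exact ⟨C, isBias_minWeight hε, fun _ _ h => bias_nonneg (fun _ y => minWeight_nonneg hε y) h, hC⟩

/-- The max rule. -/
def maxRule : SelectionRule := contestRule ε (isBias_maxWeight hε)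

/-- The min rule. -/
def minRule : SelectionRule := contestRule ε (isBias_minWeight hε)

theorem supportsRewardingExtremes_maxRule (hε₁ : ε < 1) :
    SupportsRewardingExtremes ε (maxRule hε) := by
  obtain ⟨C, hC⟩ := exists_isIndifferentBias_maxWeight hε
  refine hC.supportsRewardingExtremes hε hε₁ fun m m' h => ?_
  rw [bias_of_lt h]
  exact maxWeight_pos hε ⟨(abs_nonneg _).trans_lt h, abs_coe_message_le m⟩

theorem supportsRewardingExtremes_minRule (hε₁ : ε < 1) :
    SupportsRewardingExtremes ε (minRule hε) := by
  obtain ⟨C, hC⟩ := exists_isIndifferentBias_minWeight hε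
  refine hC.supportsRewardingExtremes hε hε₁ fun m m' h => ?_
  rw [bias_of_lt h]
  exact minWeight_pos hε ⟨abs_nonneg _, h.trans_le (abs_coe_message_le m)⟩

theorem isMaxRule_maxRule : IsMaxRule ε (maxRule hε) := by
  refine ⟨fun x => 1 / 2 + maxWeight ε hε x, fun m₁ m₂ s h1 h2 => ⟨fun h => ?_, fun h => ?_⟩⟩
  · rw [maxRule, contestRule_zero, contestProb_of_consistent h1 h2, bias_of_lt h, max_eq_left h.le]
  · rw [maxRule, contestRule_one, contestProb_of_consistent h2 h1, bias_of_lt h, max_eq_right h.le]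

theorem isMinRule_minRule : IsMinRule ε (minRule hε) := by
  refine ⟨fun x => 1 / 2 + -minWeight ε hε x, fun m₁ m₂ s h1 h2 => ⟨fun h => ?_, fun h => ?_⟩⟩
  · rw [minRule, contestRule_zero, contestProb_of_consistent h1 h2, bias_of_gt h, min_eq_left h.le]
  · rw [minRule, contestRule_one, contestProb_of_consistent h2 h1, bias_of_gt h, min_eq_right h.le]

/-- The max rule and the min rule differ with positive probability. -/
theorem totalLaw_maxRule_ne_minRule_pos (hε₁ : ε < 1) :
    0 < totalLaw ε truthfulUniform {x | (maxRule hε).prob 0 x ≠ (minRule hε).prob 0 x} := by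
  set S := {x : Obs | (maxRule hε).prob 0 x ≠ (minRule hε).prob 0 x} with hS
  have hSm : MeasurableSet S := (measurableSet_eq_fun ((maxRule hε).measurable_prob 0)
    ((minRule hε).measurable_prob 0)).compl
  refine pos_iff_ne_zero.2 fun h0 => ?_
  have hL : lawIfExpert ε truthfulUniform 0 S = 0 := by
    simp only [totalLaw, Measure.add_apply, Measure.smul_apply, smul_eq_mul, add_eq_zero,
      mul_eq_zero] at h0
    exact h0.1.resolve_left (by simp)
  have hSi : Measurable (S.indicator fun _ => (1 : ENNReal)) := measurable_const.indicator hSm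
  have hF : Measurable fun z : (Message × Message) × ℝ =>
      ENNReal.ofReal (cons ε z.1.1 z.2) * S.indicator (fun _ => 1) (z.1.1, z.1.2, z.2) := by
    refine Measurable.mul (by fun_prop) (hSi.comp (by fun_prop : Measurable
      fun z : (Message × Message) × ℝ => ((z.1.1, z.1.2, z.2) : Obs)))
  have hF1 := (hF.lintegral_prod_right' (ν := volume)).const_mul (ENNReal.ofReal (2 * ε))⁻¹
  rw [← lintegral_indicator_one hSm] at hL
  change ∫⁻ x, S.indicator (fun _ => 1) x ∂lawIfExpert ε truthfulUniform 0 = 0 at hL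
  rw [lintegral_truthful_zero hε hSi, lintegral_eq_zero_iff hF1.lintegral_prod_right'] at hL
  -- The bound `ε` is for `not_ae_maxWeight_eq_const`; the bound `1 - 2 * ε` keeps every `b` in `(ω,
  -- 1)` within `2ε` of `ω`, so that both messages can be consistent.
  have hc1 : max ε (1 - 2 * ε) < 1 := max_lt hε₁ (by linarith)
  obtain ⟨ω, hω, hωP⟩ := exists_mem_Ioo_of_ae (ae_of_ae_prior hL) hc1
  have hω2 := max_lt_iff.1 hω.1
  have hωI : ω ∈ Icc (-1 : ℝ) 1 := ⟨by linarith, hω.2.le⟩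
  have h1 := (lintegral_eq_zero_iff (hF1.comp (measurable_prodMk_left
    (x := (⟨ω, hωI⟩ : Message))))).1
    (hωP hωI)
  -- With `ω` the smaller message, the min rule's bias is fixed while the max rule's varies with
  -- `b`; agreement makes the latter constant.
  refine not_ae_maxWeight_eq_const hε hε₁ hω2.1.le hω.2 (d₀ := minWeight ε hε ω) ?_
  filter_upwards [ae_of_ae_prior h1] with b hb hbω
  have hbI : b ∈ Icc (-1 : ℝ) 1 := ⟨by linarith [hbω.1], hbω.2.le⟩
  have h2 := (mul_eq_zero.1 (hb hbI)).resolve_left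
    (ENNReal.inv_ne_zero.2 ENNReal.ofReal_ne_top)
  have hF2 := hF.comp (measurable_prodMk_left
    (x := ((⟨ω, hωI⟩, ⟨b, hbI⟩) : Message × Message)))
  have h3 := (lintegral_eq_zero_iff hF2).1 h2
  obtain ⟨s, hs, hsP⟩ := exists_mem_Ioo_of_ae h3 (by linarith [hbω.2] : b - ε < ω + ε)
  have hc : Consistent ε ⟨ω, hωI⟩ s := abs_le.2 ⟨by linarith [hs.2], by linarith [hs.1, hbω.1]⟩
  have hc' : Consistent ε ⟨b, hbI⟩ s := abs_le.2 ⟨by linarith [hs.2, hbω.1], by linarith [hs.1]⟩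
  have h4 : ((⟨ω, hωI⟩, ⟨b, hbI⟩, s) : Obs) ∉ S := by
    intro hmem
    have h5 : ENNReal.ofReal (cons ε (⟨ω, hωI⟩ : Message) s) *
      S.indicator (fun _ => 1) ((⟨ω, hωI⟩, ⟨b, hbI⟩, s) : Obs) = 0 := hsP
    rw [cons_of_consistent hc, indicator_of_mem hmem] at h5
    simp at h5
  have hω0 : |ω| = ω := abs_of_pos (by linarith)
  have hb0 : |b| = b := abs_of_pos (by linarith [hbω.1])
  have hlt : |ω| < |b| := by rw [hω0, hb0]; exact hbω.1
  have h6 := not_not.1 h4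
  rw [maxRule, minRule, contestRule_zero, contestRule_zero, contestProb_of_consistent hc hc',
    contestProb_of_consistent hc hc', bias_of_gt hlt, bias_of_gt hlt, hω0, hb0] at h6
  linarith

end

end JudgeGame

end

theorem theorem1 (ε : ℝ) (hε₀ : 0 < ε) (hε₁ : ε < 1) :
    (∀ φ : JudgeGame.SelectionRule,
      JudgeGame.IsEquilibrium ε JudgeGame.truthfulUniform φ →
        JudgeGame.IsBestEquilibrium ε JudgeGame.truthfulUniform φ) ∧
    ∃ φmax φmin : JudgeGame.SelectionRule,
      JudgeGame.SupportsRewardingExtremes ε φmax ∧ JudgeGame.IsMaxRule ε φmax ∧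
      JudgeGame.SupportsRewardingExtremes ε φmin ∧ JudgeGame.IsMinRule ε φmin ∧
      0 < JudgeGame.totalLaw ε JudgeGame.truthfulUniform
        {x | φmax.prob 0 x ≠ φmin.prob 0 x} :=
  ⟨fun _ hφ => JudgeGame.isBestEquilibrium_truthfulUniform hε₀ hφ,
    JudgeGame.maxRule hε₀, JudgeGame.minRule hε₀,
    JudgeGame.supportsRewardingExtremes_maxRule hε₀ hε₁, JudgeGame.isMaxRule_maxRule hε₀,
    JudgeGame.supportsRewardingExtremes_minRule hε₀ hε₁, JudgeGame.isMinRule_minRule hε₀,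
    JudgeGame.totalLaw_maxRule_ne_minRule_pos hε₀ hε₁⟩
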